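/- **Theorem (Boundedness near the inner boundary).** Let $N\ge 1$ be an integer, $1<p<\infty$, $0<R_1<R_2\le\infty$, and write $A_a^b:=\{x\in\mathbb R^N: a<|x|<b\}$. Let $L,K$ be real-valued measurable functions on $A_{R_1}^{R_2}$ with $L>0$ a.e., $L\in L^1_{\rm loc}(A_{R_1}^{R_2})$ and $|\{x\in A_{R_1}^{R_2}:K(x)>0\}|>0$, and let $\lambda\in\mathbb R$. Consider the problem $$-\operatorname{div}\left(L(x)|\nabla u|^{p-2}\nabla u\right)=\lambda K(x)|u|^{p-2}u\ \text{ in }A_{R_1}^{R_2},\qquad u=0\ \text{ on }\partial A_{R_1}^{R_2}.\tag{1}$$ Assume condition (A): there are functions $v,w$, measurable and positive a.e. in $(R_1,R_2)$, with $v^{-\frac1{p-1}},w\in L^1_{\rm loc}(R_1,R_2)$ such that, with $p'=\frac p{p-1}$, $\rho(r)=r^{N-1}v(r)$, $\sigma(r)=r^{N-1}w(r)$ and $$P(r):=\min\left\{\left(\int_{R_1}^r\rho^{1-p'}(\tau)\,d\tau\right)^{p-1},\left(\int_r^{R_2}\rho^{1-p'}(\tau)\,d\tau\right)^{p-1}\right\},$$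 one has $P(r)<\infty$ for all $r\in(R_1,R_2)$, $\int_{R_1}^{R_2}P(r)\sigma(r)\,dr<\infty$, and $L(x)\ge v(|x|)$, $|K(x)|\le w(|x|)$ for a.e. $x\in A_{R_1}^{R_2}$. Let $\mathcal D_0^{1,p}(A_{R_1}^{R_2};L)$ be the completion of $C_c^1(A_{R_1}^{R_2})$ in the norm $\left(\int_{A_{R_1}^{R_2}}L|\nabla u|^p\,dx\right)^{1/p}$. Under (A) it is the space of weakly differentiable functions $u$ for which there are $\varphi_n\in C_c^1(A_{R_1}^{R_2})$ with $\varphi_n\to u$ in $L^1_{\rm loc}(A_{R_1}^{R_2})$ and $\int_{A_{R_1}^{R_2}}L|\nabla\varphi_n-\nabla u|^p\,dx\to0$. A solution of (1) is a function $u\in\mathcal D_0^{1,p}(A_{R_1}^{R_2};L)$ such that $$\int_{A_{R_1}^{R_2}}L|\nabla u|^{p-2}\nabla u\cdot\nabla h\,dx=\lambda\int_{A_{R_1}^{R_2}}K|u|^{p-2}u\,h\,dx\qquad\text{for all }h\in\mathcal D_0^{1,p}(A_{R_1}^{R_2};L).$$ For $s>0$ put $p_s:=\frac{ps}{s+1}$,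 and let $p_s^\ast:=\frac{Np_s}{N-p_s}$ if $p_s<N$ and $p_s^\ast:=\infty$ if $p_s\ge N$. Assume that for some real $\epsilon$ with $0<\epsilon<\frac{R_2-R_1}2$, some real $s$ with $s>\frac Np$ and $s\ge\frac1{p-1}$, and some real $q$ with $p\le q<p_s^\ast$, $$L^{-s}\in L^1\big(A_{R_1}^{R_1+2\epsilon}\big)\quad\text{and}\quad L,K\in L^{\frac q{q-p}}\big(A_{R_1}^{R_1+2\epsilon}\big),$$ where $\frac q{q-p}:=\infty$ if $q=p$. Then there are constants $C>0$ and $\mu>0$, independent of $u$, such that every solution $u$ of (1) satisfies $u\in L^q\big(A_{R_1}^{R_1+2\epsilon}\big)\cap L^\infty\big(A_{R_1}^{R_1+\epsilon}\big)$ and $$\|u\|_{L^\infty\left(A_{R_1}^{R_1+\epsilon}\right)}\le C\left[1+\left(\int_{A_{R_1}^{R_1+2\epsilon}}|u|^q\,dx\right)^{\mu}\right].$$ -/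

import Mathlib

open MeasureTheory Filter Topology
open scoped ENNReal

/-- The open interval `(a, b)` of real numbers, where the right endpoint may be `∞`. -/
def radialInterval (a : ℝ) (b : EReal) : Set ℝ :=
  {r : ℝ | a < r ∧ (r : EReal) < b}

/-- The radial domain `{x ∈ ℝ^N : a < |x| < b}`, where `b` may be `∞`. -/
def annulus (N : ℕ) (a : ℝ) (b : EReal) : Set (EuclideanSpace ℝ (Fin N)) :=
  {x | a < ‖x‖ ∧ ((‖x‖ : ℝ) : EReal) < b}

/-- `ρ(r) = r^(N-1) v(r)` (used for `N ≥ 1` only). -/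
noncomputable def radialDensity (N : ℕ) (v : ℝ → ℝ) (r : ℝ) : ℝ :=
  r ^ (N - 1) * v r

/-- `P(r) = min {(∫_{R₁}^r ρ^{1-p'})^{p-1}, (∫_r^{R₂} ρ^{1-p'})^{p-1}}`, with values in `[0, ∞]`;
here `p' = p / (p - 1)` and `ρ(r) = r^(N-1) v(r)`. -/
noncomputable def weightP (N : ℕ) (p R₁ : ℝ) (R₂ : EReal) (v : ℝ → ℝ) (r : ℝ) : ℝ≥0∞ :=
  min
    ((∫⁻ τ in radialInterval R₁ (r : EReal),
        ENNReal.ofReal (radialDensity N v τ ^ (1 - p / (p - 1)))) ^ (p - 1))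
    ((∫⁻ τ in radialInterval r R₂,
        ENNReal.ofReal (radialDensity N v τ ^ (1 - p / (p - 1)))) ^ (p - 1))

/-- Condition (A) on the weights `L`, `K`. -/
def ConditionA (N : ℕ) (p R₁ : ℝ) (R₂ : EReal) (L K : EuclideanSpace ℝ (Fin N) → ℝ) : Prop :=
  ∃ v w : ℝ → ℝ,
    AEMeasurable v (volume.restrict (radialInterval R₁ R₂)) ∧
    AEMeasurable w (volume.restrict (radialInterval R₁ R₂)) ∧
    (∀ᵐ r ∂(volume.restrict (radialInterval R₁ R₂)), 0 < v r) ∧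
    (∀ᵐ r ∂(volume.restrict (radialInterval R₁ R₂)), 0 < w r) ∧
    LocallyIntegrableOn (fun r => v r ^ (-(1 / (p - 1)))) (radialInterval R₁ R₂) ∧
    LocallyIntegrableOn w (radialInterval R₁ R₂) ∧
    (∀ r ∈ radialInterval R₁ R₂, weightP N p R₁ R₂ v r < ∞) ∧
    (∫⁻ r in radialInterval R₁ R₂,
        weightP N p R₁ R₂ v r * ENNReal.ofReal (radialDensity N w r)) < ∞ ∧
    (∀ᵐ x ∂(volume.restrict (annulus N R₁ R₂)), v ‖x‖ ≤ L x) ∧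
    (∀ᵐ x ∂(volume.restrict (annulus N R₁ R₂)), |K x| ≤ w ‖x‖)

/-- `φ ∈ C_c^1(Ω)`. -/
structure IsC1c {N : ℕ} (Ω : Set (EuclideanSpace ℝ (Fin N)))
    (φ : EuclideanSpace ℝ (Fin N) → ℝ) : Prop where
  contDiff : ContDiff ℝ 1 φ
  hasCompactSupport : HasCompactSupport φ
  tsupport_subset : tsupport φ ⊆ Ω

/-- `u ∈ L^1_loc(Ω)` has the weak gradient `G ∈ L^1_loc(Ω; ℝ^N)` in the open set `Ω`:
`∫_Ω u ∂_e φ = - ∫_Ω (G · e) φ` for all directions `e` and all `φ ∈ C_c^∞(Ω)`. -/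
structure HasWeakGradient {N : ℕ} (Ω : Set (EuclideanSpace ℝ (Fin N)))
    (u : EuclideanSpace ℝ (Fin N) → ℝ)
    (G : EuclideanSpace ℝ (Fin N) → EuclideanSpace ℝ (Fin N)) : Prop where
  locallyIntegrableOn : LocallyIntegrableOn u Ω
  locallyIntegrableOn_grad : LocallyIntegrableOn G Ω
  integral_eq : ∀ (φ : EuclideanSpace ℝ (Fin N) → ℝ) (e : EuclideanSpace ℝ (Fin N)),
    ContDiff ℝ ((⊤ : ℕ∞) : WithTop ℕ∞) φ → HasCompactSupport φ → tsupport φ ⊆ Ω →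
      ∫ x in Ω, u x * fderiv ℝ φ x e = -∫ x in Ω, inner ℝ (G x) e * φ x

/-- `u ∈ D_0^{1,p}(Ω; L)` with weak gradient `G`.

`D_0^{1,p}(Ω; L)` is the completion of `C_c^1(Ω)` in the norm `(∫_Ω L |∇φ|^p)^(1/p)`. On radial
domains and under condition (A), a sequence in `C_c^1(Ω)` that is Cauchy in this norm converges in
`L^1_loc(Ω)` to a function `u`, its gradients converge in `L^p(Ω; L)` to the weak gradient `G`
of `u`, and the class of the sequence is determined by `u`. The completion is realised here, in the
usual way, as the space of these limits `u`. -/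
structure MemD0 {N : ℕ} (p : ℝ) (Ω : Set (EuclideanSpace ℝ (Fin N)))
    (L : EuclideanSpace ℝ (Fin N) → ℝ) (u : EuclideanSpace ℝ (Fin N) → ℝ)
    (G : EuclideanSpace ℝ (Fin N) → EuclideanSpace ℝ (Fin N)) : Prop where
  hasWeakGradient : HasWeakGradient Ω u G
  exists_approx : ∃ φ : ℕ → EuclideanSpace ℝ (Fin N) → ℝ,
    (∀ n, IsC1c Ω (φ n)) ∧
    (∀ S : Set (EuclideanSpace ℝ (Fin N)), IsCompact S → S ⊆ Ω →
      Tendsto (fun n => ∫⁻ x in S, ‖φ n x - u x‖ₑ) atTop (𝓝 0)) ∧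
    Tendsto (fun n => ∫⁻ x in Ω, ENNReal.ofReal (L x * ‖gradient (φ n) x - G x‖ ^ p))
      atTop (𝓝 0)

/-- `u` is a weak solution of `-div (L |∇u|^{p-2} ∇u) = lam K |u|^{p-2} u` in `Ω`, `u = 0` on `∂Ω`:
`u ∈ D_0^{1,p}(Ω; L)` and the integral identity holds for all test functions `h ∈ D_0^{1,p}(Ω; L)`.
(`G` and `H` are the weak gradients of `u` and `h`.) -/
def IsWeakSolution {N : ℕ} (p : ℝ) (Ω : Set (EuclideanSpace ℝ (Fin N)))
    (L K : EuclideanSpace ℝ (Fin N) → ℝ) (lam : ℝ)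
    (u : EuclideanSpace ℝ (Fin N) → ℝ) : Prop :=
  ∃ G : EuclideanSpace ℝ (Fin N) → EuclideanSpace ℝ (Fin N),
    MemD0 p Ω L u G ∧
    ∀ (h : EuclideanSpace ℝ (Fin N) → ℝ)
      (H : EuclideanSpace ℝ (Fin N) → EuclideanSpace ℝ (Fin N)),
      MemD0 p Ω L h H →
        ∫ x in Ω, L x * ‖G x‖ ^ (p - 2) * inner ℝ (G x) (H x) =
          lam * ∫ x in Ω, K x * |u x| ^ (p - 2) * u x * h x

/-- `p_s = p s / (s + 1)`. -/
noncomputable def pSub (p s : ℝ) : ℝ := p * s / (s + 1)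

/-- The Sobolev exponent `α^* = N α / (N - α)` if `α < N` and `α^* = ∞` if `α ≥ N`. -/
noncomputable def sobolevExp (N : ℕ) (α : ℝ) : EReal :=
  if α < (N : ℝ) then (((N : ℝ) * α / ((N : ℝ) - α) : ℝ) : EReal) else ⊤

/-- The exponent `q / (q - p)` for `0 < p ≤ q`, with `q / 0 = ∞`. -/
noncomputable def weightExp (p q : ℝ) : ℝ≥0∞ :=
  ENNReal.ofReal q / ENNReal.ofReal (q - p)

/-! The proof is Moser's iteration on annuli `R₁ < |x| < b` with shrinking `b`, driven by a Sobolev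
inequality that raises integrability from `q` to some `Q > q`.

Gain of integrability. Hölder's inequality with `L⁻ˢ` integrable turns the weighted `L^p` norm of a
gradient into an unweighted `L^{p_s}` norm; `s ≥ 1/(p-1)` says that `p_s ≥ 1`, and `q < p_s^*`
leaves room above `q`. Elements of `D_0` vanish at the inner sphere but not at `|x| = R₁ + 2ε`, so a
test function is first extended by inversion across that sphere, which costs only a constant factor
in the gradient norm. This gives `exists_eLpNorm_annulus_le_eLpNorm_fderiv` and then
`exists_weighted_sobolev`.

Energy estimate. For a radial cutoff `η` and `γ ≥ 1`, the equation is tested with `η^p F(u)`, where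
`F' = min(|t|, M)^{p(γ-1)}`. Young's inequality absorbs the mixed term. What remains is of the form
`L |∇η|^p |u|^{pγ}` and `K |u|^{pγ}`, and Hölder's inequality with `L, K ∈ L^{q/(q-p)}` bounds both
by the `L^q` norm of `|u|^γ` (`eLpNorm_mul_truncPowPrim_le`). The truncation at `M` makes the test
function admissible (`memD0_mul_comp`) and all integrals finite; Fatou's lemma removes it. With
Sobolev's inequality, the norm of `u` in `L^{Qγ}` on a smaller annulus is bounded by the one in
`L^{qγ}` on a larger annulus (`exists_moser_step`).

Iteration. With `γ = (Q/q)^k` and gaps between radii proportional to `2^{-k}`, the constant of step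
`k` grows geometrically but enters with the power `1/γ`, so the product converges
(`exists_bound_of_iteration`). The outcome is the linear bound of the sup norm by the `L^q` norm, so
`μ = 1/q` is admissible. -/

/-! ### Annuli and radial cutoffs -/

theorem mem_annulus_coe {N : ℕ} {a b : ℝ} {x : EuclideanSpace ℝ (Fin N)} :
    x ∈ annulus N a (b : EReal) ↔ a < ‖x‖ ∧ ‖x‖ < b := by
  simp [annulus]

theorem isOpen_annulus (N : ℕ) (a : ℝ) (b : EReal) : IsOpen (annulus N a b) :=
  (isOpen_lt continuous_const continuous_norm).inter
    (isOpen_lt (continuous_coe_real_ereal.comp continuous_norm) continuous_const)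

theorem measurableSet_annulus (N : ℕ) (a : ℝ) (b : EReal) : MeasurableSet (annulus N a b) :=
  (isOpen_annulus N a b).measurableSet

theorem annulus_subset_annulus {N : ℕ} {a : ℝ} {b c : EReal} (h : b ≤ c) :
    annulus N a b ⊆ annulus N a c := fun _ hx => ⟨hx.1, hx.2.trans_le h⟩

theorem isBounded_annulus (N : ℕ) (a b : ℝ) :
    Bornology.IsBounded (annulus N a (b : EReal)) :=
  (Metric.isBounded_ball (x := (0 : EuclideanSpace ℝ (Fin N))) (r := b)).subset fun x hx => by
    simpa using (mem_annulus_coe.1 hx).2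

theorem volume_annulus_lt_top (N : ℕ) (a b : ℝ) : volume (annulus N a (b : EReal)) < ∞ :=
  (isBounded_annulus N a b).measure_lt_top

/-- Radial cutoff functions with the natural gradient bound. -/
theorem exists_radial_cutoff (F : Type*) [NormedAddCommGroup F] [InnerProductSpace ℝ F] :
    ∃ D : ℝ, 0 < D ∧ ∀ a b : ℝ, 0 < a → a < b → ∃ η : F → ℝ,
      ContDiff ℝ ((⊤ : ℕ∞) : WithTop ℕ∞) η ∧ (∀ x, 0 ≤ η x) ∧ (∀ x, η x ≤ 1) ∧
      (∀ x, ‖x‖ ≤ a → η x = 1) ∧ (∀ x, b ≤ ‖x‖ → η x = 0) ∧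
      ∀ x, ‖fderiv ℝ η x‖ ≤ D / (b - a) := by
  have hc : Continuous (deriv Real.smoothTransition) :=
    (Real.smoothTransition.contDiff (n := 1)).continuous_deriv le_rfl
  obtain ⟨M, hM⟩ := (isCompact_Icc (a := (0 : ℝ)) (b := 1)).exists_bound_of_continuousOn
    hc.continuousOn
  have hd : ∀ t, ‖deriv Real.smoothTransition t‖ ≤ |M| := by
    intro t
    by_cases ht : t ∈ Set.Icc (0 : ℝ) 1
    · exact (hM t ht).trans (le_abs_self M)
    · have : deriv Real.smoothTransition t = 0 := by
        rw [Set.mem_Icc, not_and_or, not_le, not_le] at ht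
        rcases ht with ht | ht
        · have : Real.smoothTransition =ᶠ[𝓝 t] fun _ => 0 := by
            filter_upwards [Iio_mem_nhds ht] with y hy
            exact Real.smoothTransition.zero_of_nonpos (le_of_lt hy)
          simpa using this.deriv_eq
        · have : Real.smoothTransition =ᶠ[𝓝 t] fun _ => 1 := by
            filter_upwards [Ioi_mem_nhds ht] with y hy
            exact Real.smoothTransition.one_of_one_le (le_of_lt hy)
          simpa using this.deriv_eq
      rw [this]; simp
  refine ⟨2 * |M| + 1, by positivity, fun a b ha hab => ?_⟩
  have hb : 0 < b := ha.trans hab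
  have hba : 0 < b ^ 2 - a ^ 2 := by nlinarith
  -- Interpolating in `‖x‖²` instead of `‖x‖` keeps the cutoff smooth at the origin. The gradient of
  -- `g` is at most `2b / (b² - a²) ≤ 2 / (b - a)` where `‖x‖ < b`.
  set g : F → ℝ := fun x => (b ^ 2 - ‖x‖ ^ 2) / (b ^ 2 - a ^ 2) with hg
  have hgc : ContDiff ℝ ((⊤ : ℕ∞) : WithTop ℕ∞) g :=
    (contDiff_const.sub (contDiff_norm_sq ℝ)).div_const _
  have hηc : ContDiff ℝ ((⊤ : ℕ∞) : WithTop ℕ∞) (fun x => Real.smoothTransition (g x)) :=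
    Real.smoothTransition.contDiff.comp hgc
  have hz : ∀ x : F, b ≤ ‖x‖ → Real.smoothTransition (g x) = 0 := fun x hx =>
    Real.smoothTransition.zero_of_nonpos (div_nonpos_of_nonpos_of_nonneg
      (by nlinarith [norm_nonneg x]) hba.le)
  refine ⟨fun x => Real.smoothTransition (g x), hηc, fun x => Real.smoothTransition.nonneg _,
    fun x => Real.smoothTransition.le_one _, fun x hx => ?_, hz, fun x => ?_⟩
  · apply Real.smoothTransition.one_of_one_le
    rw [hg, le_div_iff₀ hba]
    nlinarith [norm_nonneg x]
  · have hpos : 0 < (2 * |M| + 1) / (b - a) := by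
      have := abs_nonneg M; have := sub_pos.2 hab; positivity
    -- Where the cutoff vanishes it has a minimum, so its derivative is zero there, including on the
    -- sphere `‖x‖ = b`.
    rcases le_or_gt b ‖x‖ with hx | hx
    · have hmin : IsLocalMin (fun x => Real.smoothTransition (g x)) x :=
        Eventually.of_forall fun y => by
          simp only [hz x hx]; exact Real.smoothTransition.nonneg _
      rw [hmin.fderiv_eq_zero]; simpa using hpos.le
    · have h1 : HasFDerivAt g ((b ^ 2 - a ^ 2)⁻¹ • (-(2 • innerSL ℝ x : F →L[ℝ] ℝ))) x := by
        have := ((hasStrictFDerivAt_norm_sq x).hasFDerivAt.const_sub (b ^ 2)).const_smul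
          (b ^ 2 - a ^ 2)⁻¹
        refine this.congr_of_eventuallyEq (Eventually.of_forall fun y => ?_)
        simp [hg, div_eq_inv_mul]
      have h2 : HasDerivAt Real.smoothTransition (deriv Real.smoothTransition (g x)) (g x) :=
        (Real.smoothTransition.contDiff (n := 1)).differentiable one_ne_zero |>.differentiableAt
          |>.hasDerivAt
      have h3 := h2.comp_hasFDerivAt x h1
      have h4 : fderiv ℝ (fun x => Real.smoothTransition (g x)) x = _ := h3.fderiv
      rw [h4, norm_smul, norm_smul, norm_neg, ← Nat.cast_smul_eq_nsmul ℝ, norm_smul,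
        innerSL_apply_norm, norm_inv, Real.norm_of_nonneg hba.le]
      have h5 : (b ^ 2 - a ^ 2)⁻¹ * (‖((2 : ℕ) : ℝ)‖ * ‖x‖) ≤ 2 / (b - a) := by
        rw [inv_mul_le_iff₀ hba]
        have : (b ^ 2 - a ^ 2) * (2 / (b - a)) = 2 * (b + a) := by
          have := (sub_pos.2 hab).ne'
          field_simp; ring
        rw [this]; simp; linarith
      calc _ ≤ |M| * (2 / (b - a)) := by gcongr; exact hd _
        _ = 2 * |M| / (b - a) := by ring
        _ ≤ _ := by
          have := sub_pos.2 hab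
          gcongr; linarith

/-! ### Sobolev's inequality for compact supports -/

theorem eLpNorm_le_eLpNorm_mul_of_support_subset {N : ℕ} {F : Type*} [NormedAddCommGroup F]
    {t : Set (EuclideanSpace ℝ (Fin N))}
    {g : EuclideanSpace ℝ (Fin N) → F} (hg : AEStronglyMeasurable g volume)
    (hgt : Function.support g ⊆ t) {p q : ℝ≥0∞} (hpq : p ≤ q) :
    eLpNorm g p volume ≤ eLpNorm g q volume * volume t ^ (1 / p.toReal - 1 / q.toReal) := by
  rw [← eLpNorm_restrict_eq_of_support_subset hgt,
    ← eLpNorm_restrict_eq_of_support_subset (p := q) hgt]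
  simpa using eLpNorm_le_eLpNorm_mul_rpow_measure_univ (μ := volume.restrict t) hpq hg.restrict

/-- The fundamental theorem of calculus on a half-line, transported through the isometry `t ↦ t •
e`. It replaces the Gagliardo–Nirenberg–Sobolev inequality when `N = 1`. -/
theorem enorm_le_lintegral_fderiv_fin_one {φ : EuclideanSpace ℝ (Fin 1) → ℝ}
    (h1 : ContDiff ℝ 1 φ) (h2 : HasCompactSupport φ) (x : EuclideanSpace ℝ (Fin 1)) :
    ‖φ x‖ₑ ≤ ∫⁻ y, ‖fderiv ℝ φ y‖ₑ := by
  set e : EuclideanSpace ℝ (Fin 1) := EuclideanSpace.single 0 1 with he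
  have hee : ‖e‖ = 1 := by simp [he]
  let l : ℝ →ₗᵢ[ℝ] EuclideanSpace ℝ (Fin 1) := LinearIsometry.toSpanSingleton ℝ _ hee
  have hl : ∀ t, l t = t • e := fun t => rfl
  have hmp : MeasurePreserving (fun t : ℝ => l t) volume volume := by
    have hr : Module.finrank ℝ ℝ = Module.finrank ℝ (EuclideanSpace ℝ (Fin 1)) := by simp
    exact (l.toLinearIsometryEquiv hr).measurePreserving
  have hx : x = l (x 0) := by
    ext i; fin_cases i; simp [hl, he]
  have hc : ContDiff ℝ 1 fun t => φ (l t) := h1.comp l.toContinuousLinearMap.contDiff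
  have hs : HasCompactSupport fun t => φ (l t) := h2.comp_isClosedEmbedding l.isometry.isClosedEmbedding
  have := hs.enorm_le_lintegral_Ici_deriv hc (x 0)
  rw [← hx] at this
  refine this.trans ((setLIntegral_le_lintegral _ _).trans ?_)
  have hcont : Continuous fun y => ‖fderiv ℝ φ y‖ₑ :=
    (h1.continuous_fderiv one_ne_zero).enorm
  rw [← hmp.lintegral_comp hcont.measurable]
  gcongr with t
  have hd : HasDerivAt (fun t => φ (l t)) (fderiv ℝ φ (l t) e) t := by
    have h3 := ((h1.differentiable one_ne_zero).differentiableAt (x := l t)).hasFDerivAt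
    have h4 : HasDerivAt (fun t : ℝ => l t) e t := by
      simpa [hl] using (hasDerivAt_id t).smul_const e
    exact h3.comp_hasDerivAt t h4
  rw [hd.deriv]
  calc ‖fderiv ℝ φ (l t) e‖ₑ ≤ ‖fderiv ℝ φ (l t)‖ₑ * ‖e‖ₑ := ContinuousLinearMap.le_opENorm _ _
    _ = _ := by rw [← ofReal_norm e, hee]; simp

/-- Sobolev's inequality for compactly supported functions, with subcritical exponents and in
every dimension `N ≥ 1`. -/
theorem exists_eLpNorm_le_eLpNorm_fderiv {N : ℕ} (hN : 1 ≤ N)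
    {s : Set (EuclideanSpace ℝ (Fin N))} (hs : Bornology.IsBounded s)
    {P Q : ℝ} (hP : 1 ≤ P) (hQ : 1 ≤ Q) (hPQ : P < N → 1 / P - 1 / N ≤ 1 / Q) :
    ∃ C : NNReal, ∀ φ : EuclideanSpace ℝ (Fin N) → ℝ, ContDiff ℝ 1 φ →
      Function.support φ ⊆ s →
      eLpNorm φ (ENNReal.ofReal Q) volume ≤
        C * eLpNorm (fderiv ℝ φ) (ENNReal.ofReal P) volume := by
  have hst : volume (closure s) ≠ ∞ := hs.closure.measure_lt_top.ne
  have hsupp : ∀ φ : EuclideanSpace ℝ (Fin N) → ℝ, Function.support φ ⊆ s →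
      Function.support (fderiv ℝ φ) ⊆ closure s := fun φ hφ =>
    (support_fderiv_subset ℝ).trans (closure_mono hφ)
  have hcpt : ∀ φ : EuclideanSpace ℝ (Fin N) → ℝ, Function.support φ ⊆ s →
      HasCompactSupport φ := fun φ hφ =>
    (Metric.isCompact_of_isClosed_isBounded isClosed_closure hs.closure).of_isClosed_subset
      (isClosed_tsupport _) (closure_mono hφ)
  have hmeas : ∀ φ : EuclideanSpace ℝ (Fin N) → ℝ, ContDiff ℝ 1 φ →
      AEStronglyMeasurable (fderiv ℝ φ) volume := fun φ hφ =>
    (hφ.continuous_fderiv one_ne_zero).aestronglyMeasurable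
  -- The gradient lives on a set of finite measure, so its exponent may be lowered to any `α ∈ [1,
  -- P]`; this allows `α < N` even when `P ≥ N`.
  suffices H : ∃ α : ℝ, 1 ≤ α ∧ α ≤ P ∧ ∃ C : NNReal, ∀ φ : EuclideanSpace ℝ (Fin N) → ℝ,
      ContDiff ℝ 1 φ → Function.support φ ⊆ s →
      eLpNorm φ (ENNReal.ofReal Q) volume ≤
        C * eLpNorm (fderiv ℝ φ) (ENNReal.ofReal α) volume by
    obtain ⟨α, hα, hαP, C, hC⟩ := H
    have hexp : 0 ≤ 1 / (ENNReal.ofReal α).toReal - 1 / (ENNReal.ofReal P).toReal := by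
      rw [ENNReal.toReal_ofReal (by linarith), ENNReal.toReal_ofReal (by linarith), sub_nonneg]
      exact one_div_le_one_div_of_le (by linarith) hαP
    have hfin : volume (closure s) ^
        (1 / (ENNReal.ofReal α).toReal - 1 / (ENNReal.ofReal P).toReal) ≠ ∞ :=
      ENNReal.rpow_ne_top_of_nonneg hexp hst
    refine ⟨C * (volume (closure s) ^
        (1 / (ENNReal.ofReal α).toReal - 1 / (ENNReal.ofReal P).toReal)).toNNReal,
      fun φ h1 h2 => (hC φ h1 h2).trans ?_⟩
    rw [ENNReal.coe_mul, ENNReal.coe_toNNReal hfin, mul_assoc]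
    gcongr
    rw [mul_comm]
    exact eLpNorm_le_eLpNorm_mul_of_support_subset (hmeas φ h1) (hsupp φ h2)
      (ENNReal.ofReal_le_ofReal hαP)
  rcases Nat.lt_or_ge 1 N with hN2 | hN1
  · have hNr : (1 : ℝ) < N := by exact_mod_cast hN2
    obtain ⟨α, h1, h2, h3, h4⟩ : ∃ α : ℝ, 1 ≤ α ∧ α ≤ P ∧ α < N ∧ 1 / α - 1 / N ≤ 1 / Q := by
      by_cases hPN : P < N
      · exact ⟨P, hP, le_rfl, hPN, hPQ hPN⟩
      -- `NQ / (N + Q)` is the exponent whose Sobolev conjugate is `Q`, and it is always below `N`.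
      -- The maximum with `1` keeps the exponent admissible.
      · refine ⟨max 1 (N * Q / (N + Q)), le_max_left _ _, ?_, ?_, ?_⟩
        · refine max_le hP (le_trans ?_ (not_lt.1 hPN))
          rw [div_le_iff₀ (by linarith)]; nlinarith
        · refine max_lt hNr ?_
          rw [div_lt_iff₀ (by linarith)]; nlinarith
        · have : 1 / max 1 (N * Q / (N + Q)) ≤ 1 / (N * Q / (N + Q)) :=
            one_div_le_one_div_of_le (by positivity) (le_max_right _ _)
          have h5 : 1 / ((N : ℝ) * Q / (N + Q)) = 1 / Q + 1 / N := by
            have : (N : ℝ) ≠ 0 := by positivity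
            field_simp
          linarith
    refine ⟨α, h1, h2, eLpNormLESNormFDerivOfLeConst ℝ
      (volume : Measure (EuclideanSpace ℝ (Fin N))) s α.toNNReal Q.toNNReal, fun φ hφ hφs => ?_⟩
    have hα0 : 0 ≤ α := by linarith
    have hQ0 : 0 ≤ Q := by linarith
    refine eLpNorm_le_eLpNorm_fderiv_of_le volume hφ hφs (by simpa using h1) ?_ ?_ hs
    · simpa [← NNReal.coe_lt_coe, hα0] using h3
    · simpa [hα0, hQ0] using h4
  -- No `α ∈ [1, N)` exists here. The choice `α = 1` works with the sup bound, followed by Hölder's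
  -- inequality on the bounded support.
  · obtain rfl : N = 1 := le_antisymm hN1 hN
    have hQ0 : 0 ≤ (ENNReal.ofReal Q).toReal⁻¹ := by positivity
    have hfin : volume (closure s) ^ (ENNReal.ofReal Q).toReal⁻¹ ≠ ∞ :=
      ENNReal.rpow_ne_top_of_nonneg hQ0 hst
    refine ⟨1, le_rfl, hP, (volume (closure s) ^ (ENNReal.ofReal Q).toReal⁻¹).toNNReal,
      fun φ h1 h2 => ?_⟩
    rw [ENNReal.coe_toNNReal hfin]
    have h3 := eLpNorm_le_eLpNorm_mul_of_support_subset (p := ENNReal.ofReal Q) (q := ∞)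
      h1.continuous.aestronglyMeasurable (h2.trans subset_closure) le_top
    refine h3.trans ?_
    rw [mul_comm]
    have hexp : 1 / (ENNReal.ofReal Q).toReal - 1 / (∞ : ℝ≥0∞).toReal =
        (ENNReal.ofReal Q).toReal⁻¹ := by simp
    rw [hexp]
    gcongr
    · rw [ENNReal.ofReal_one, eLpNorm_one_eq_lintegral_enorm, eLpNorm_exponent_top]
      exact essSup_le_of_ae_le _ (Eventually.of_forall fun x =>
        enorm_le_lintegral_fderiv_fin_one h1 (hcpt φ h2) x)

/-! ### Reflection across a sphere -/

section Inversion

open EuclideanGeometry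

variable {N : ℕ} {φ : EuclideanSpace ℝ (Fin N) → ℝ} {r T : ℝ}

theorem norm_inversion_zero (T : ℝ) (x : EuclideanSpace ℝ (Fin N)) :
    ‖inversion 0 T x‖ = T ^ 2 / ‖x‖ := by
  simpa using dist_inversion_center (0 : EuclideanSpace ℝ (Fin N)) x T

/-- The distance equals `(‖x‖ - T)(1 + T / ‖x‖)`. On a shell of width `δ` outside the sphere, a
Lipschitz function and its reflection thus differ by `O(δ)`, which offsets the `1/δ` of a cutoff's
gradient. -/
theorem norm_sub_inversion_zero (hT : 0 < T) {x : EuclideanSpace ℝ (Fin N)} (hx : T ≤ ‖x‖) :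
    ‖x - inversion 0 T x‖ ≤ 2 * (‖x‖ - T) := by
  have hx0 : 0 < ‖x‖ := hT.trans_le hx
  have h : x - inversion 0 T x = (1 - (T / ‖x‖) ^ 2) • x := by
    simp [inversion, sub_smul]
  have h1 : T / ‖x‖ ≤ 1 := (div_le_one hx0).2 hx
  have h0 : 0 ≤ T / ‖x‖ := by positivity
  rw [h, norm_smul, Real.norm_of_nonneg (by nlinarith)]
  have h2 : T / ‖x‖ * ‖x‖ = T := by field_simp
  nlinarith

/-- The centre is the only critical point. Points near it are sent outside the support, so the
composition vanishes nearby; `φ 0 = 0` settles the centre itself, which `inversion` fixes by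
convention. -/
theorem contDiff_comp_inversion (hT : 0 < T) (h1 : ContDiff ℝ 1 φ) (h2 : HasCompactSupport φ)
    (hφ0 : φ 0 = 0) : ContDiff ℝ 1 fun x => φ (inversion 0 T x) := by
  rw [contDiff_iff_contDiffAt]
  intro x
  by_cases hx : x = 0
  · subst hx
    obtain ⟨M, hM⟩ := h2.isCompact.isBounded.exists_norm_le
    have hMpos : 0 < |M| + 1 := by positivity
    have : (fun x => φ (inversion 0 T x)) =ᶠ[𝓝 0] fun _ => 0 := by
      filter_upwards [Metric.ball_mem_nhds (0 : EuclideanSpace ℝ (Fin N))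
        (show 0 < T ^ 2 / (|M| + 1) by positivity)] with y hy
      by_cases hy0 : y = 0
      · simp [hy0, hφ0]
      · by_contra hne
        have h3 := hM _ (subset_tsupport φ hne)
        rw [norm_inversion_zero, div_le_iff₀ (norm_pos_iff.2 hy0)] at h3
        rw [mem_ball_zero_iff, lt_div_iff₀ hMpos] at hy
        have := le_abs_self M
        nlinarith [norm_nonneg y]
    exact contDiffAt_const.congr_of_eventuallyEq this
  · exact h1.contDiffAt.comp x
      (contDiffAt_const.inversion contDiffAt_const contDiffAt_id hx)

/-- The derivative of the inversion is `(T / ‖x‖)²` times a reflection, which is an isometry. -/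
theorem norm_fderiv_comp_inversion_le (h1 : ContDiff ℝ 1 φ)
    {x : EuclideanSpace ℝ (Fin N)} (hx : x ≠ 0) :
    ‖fderiv ℝ (fun x => φ (inversion 0 T x)) x‖ ≤
      (T / ‖x‖) ^ 2 * ‖fderiv ℝ φ (inversion 0 T x)‖ := by
  have h3 := ((h1.differentiable one_ne_zero).differentiableAt
    (x := inversion 0 T x)).hasFDerivAt.comp x (hasFDerivAt_inversion (R := T) hx)
  have h4 : fderiv ℝ (fun x => φ (inversion 0 T x)) x = _ := h3.fderiv
  rw [h4]
  refine (ContinuousLinearMap.opNorm_comp_le _ _).trans ?_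
  rw [mul_comm, norm_smul, Real.norm_of_nonneg (by positivity)]
  gcongr
  simp only [dist_zero_right]
  refine mul_le_of_le_one_right (by positivity) ?_
  exact LinearIsometry.norm_toContinuousLinearMap_le
    ((Submodule.span ℝ {x - 0})ᗮ.reflection.toLinearIsometry)

theorem abs_det_fderiv_inversion (x : EuclideanSpace ℝ (Fin N)) :
    |(((T / dist x 0) ^ 2 • ((Submodule.span ℝ {x - 0})ᗮ.reflection :
      EuclideanSpace ℝ (Fin N) →L[ℝ] EuclideanSpace ℝ (Fin N)))).det| = (T / ‖x‖) ^ (2 * N) := by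
  have : (((T / dist x 0) ^ 2 • ((Submodule.span ℝ {x - 0})ᗮ.reflection :
      EuclideanSpace ℝ (Fin N) →L[ℝ] EuclideanSpace ℝ (Fin N)))).det =
      ((T / ‖x‖) ^ 2) ^ N * LinearMap.det
        (Submodule.span ℝ {x - 0})ᗮ.reflection.toLinearMap := by
    have := LinearMap.det_smul ((T / ‖x‖) ^ 2)
        ((Submodule.span ℝ {x - 0})ᗮ.reflection.toLinearMap)
    rw [finrank_euclideanSpace_fin] at this
    rw [← this, dist_zero_right]
    rfl
  rw [this, Submodule.det_reflection, abs_mul, abs_neg_one_pow, mul_one,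
    abs_of_nonneg (by positivity), ← pow_mul]

theorem inversion_image_annulus (hr : 0 < r) (hT : 0 < T) :
    inversion (0 : EuclideanSpace ℝ (Fin N)) T '' annulus N T ((T ^ 2 / r : ℝ) : EReal) =
      annulus N r (T : EReal) := by
  ext y
  constructor
  · rintro ⟨x, hx, rfl⟩
    rw [mem_annulus_coe] at hx
    have hx0 : 0 < ‖x‖ := hT.trans hx.1
    rw [mem_annulus_coe, norm_inversion_zero, lt_div_iff₀ hx0, div_lt_iff₀ hx0]
    have := (lt_div_iff₀ hr).1 hx.2
    constructor <;> nlinarith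
  · intro hy
    rw [mem_annulus_coe] at hy
    have hy0 : 0 < ‖y‖ := hr.trans hy.1
    refine ⟨inversion 0 T y, ?_, inversion_inversion _ hT.ne' y⟩
    rw [mem_annulus_coe, norm_inversion_zero, lt_div_iff₀ hy0]
    refine ⟨by nlinarith, ?_⟩
    exact div_lt_div_of_pos_left (by positivity) hr hy.1

/-- The gradient of the reflection of `φ` across the sphere of radius `T` is controlled by the
gradient of `φ` inside. -/
theorem eLpNorm_fderiv_comp_inversion_le (hr : 0 < r) (hrT : r < T) {P : ℝ} (hP : 1 ≤ P)
    (h1 : ContDiff ℝ 1 φ) (hφ : ∀ x ∈ tsupport φ, r < ‖x‖) :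
    eLpNorm (fderiv ℝ fun x => φ (inversion 0 T x)) (ENNReal.ofReal P)
        (volume.restrict {x | T < ‖x‖}) ≤
      ENNReal.ofReal ((T / r) ^ (2 * N)) ^ (1 / P) *
        eLpNorm (fderiv ℝ φ) (ENNReal.ofReal P) (volume.restrict (annulus N r (T : EReal))) := by
  have hT : 0 < T := hr.trans hrT
  have hP0 : 0 < P := by linarith
  have hP' : ENNReal.ofReal P ≠ 0 := by simpa using hP0
  have hbase : ∫⁻ x in {x : EuclideanSpace ℝ (Fin N) | T < ‖x‖},
        ‖fderiv ℝ (fun x => φ (inversion 0 T x)) x‖ₑ ^ P ≤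
      ENNReal.ofReal ((T / r) ^ (2 * N)) *
        ∫⁻ x in annulus N r (T : EReal), ‖fderiv ℝ φ x‖ₑ ^ P := by
    -- Beyond radius `T² / r` the inverted point has norm at most `r`, where `φ` vanishes. Only a
    -- bounded annulus contributes.
    have hzero : ∀ x : EuclideanSpace ℝ (Fin N), T ^ 2 / r ≤ ‖x‖ → T < ‖x‖ →
        fderiv ℝ φ (inversion 0 T x) = 0 := by
      intro x hx hx'
      by_contra hne
      have h3 := hφ _ (support_fderiv_subset ℝ hne)
      rw [norm_inversion_zero, lt_div_iff₀ (hT.trans hx')] at h3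
      rw [div_le_iff₀ hr] at hx
      linarith
    have hsub : ∫⁻ x in {x : EuclideanSpace ℝ (Fin N) | T < ‖x‖},
        ‖fderiv ℝ (fun x => φ (inversion 0 T x)) x‖ₑ ^ P ≤
        ∫⁻ x in annulus N T ((T ^ 2 / r : ℝ) : EReal), ‖fderiv ℝ φ (inversion 0 T x)‖ₑ ^ P := by
      rw [← lintegral_indicator (isOpen_lt continuous_const continuous_norm).measurableSet,
        ← lintegral_indicator (measurableSet_annulus _ _ _)]
      refine lintegral_mono fun x => ?_
      by_cases hx : T < ‖x‖
      · rw [Set.indicator_of_mem (by exact hx)]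
        have hx0 : 0 < ‖x‖ := hT.trans hx
        have h3 : ‖fderiv ℝ (fun x => φ (inversion 0 T x)) x‖ ≤
            ‖fderiv ℝ φ (inversion 0 T x)‖ := by
          refine (norm_fderiv_comp_inversion_le h1 (norm_pos_iff.1 hx0)).trans ?_
          refine mul_le_of_le_one_left (norm_nonneg _) (pow_le_one₀ (by positivity) ?_)
          exact (div_le_one hx0).2 hx.le
        rcases lt_or_ge ‖x‖ (T ^ 2 / r) with hx2 | hx2
        · rw [Set.indicator_of_mem (mem_annulus_coe.2 ⟨hx, hx2⟩)]
          gcongr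
          rwa [enorm_le_iff_norm_le]
        · rw [hzero x hx2 hx, norm_zero] at h3
          have h4 : ‖fderiv ℝ (fun x => φ (inversion 0 T x)) x‖ₑ = 0 := by
            rw [← ofReal_norm, le_antisymm h3 (norm_nonneg _), ENNReal.ofReal_zero]
          rw [h4, ENNReal.zero_rpow_of_pos hP0]
          exact zero_le
      · rw [Set.indicator_of_notMem (by exact hx)]
        exact zero_le
    refine hsub.trans ?_
    -- Change of variables: on this annulus `T / ‖x‖ > r / T`, so the Jacobian `(T / ‖x‖)^{2N}` is
    -- at least `(r / T)^{2N}`, whence the constant `(T / r)^{2N}`.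
    rw [← inversion_image_annulus hr hT, lintegral_image_eq_lintegral_abs_det_fderiv_mul volume
      (measurableSet_annulus _ _ _) (fun x hx => (hasFDerivAt_inversion (R := T)
        (norm_pos_iff.1 (hT.trans hx.1))).hasFDerivWithinAt)
      (inversion_injective _ hT.ne').injOn, ← lintegral_const_mul' _ _ ENNReal.ofReal_ne_top]
    refine setLIntegral_mono' (measurableSet_annulus _ _ _) fun x hx => ?_
    rw [mem_annulus_coe] at hx
    have hx0 : 0 < ‖x‖ := hT.trans hx.1
    rw [abs_det_fderiv_inversion, ← mul_assoc, ← ENNReal.ofReal_mul (by positivity), ← mul_pow]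
    refine le_mul_of_one_le_left zero_le ?_
    rw [ENNReal.one_le_ofReal]
    refine one_le_pow₀ ?_
    have := (lt_div_iff₀ hr).1 hx.2
    rw [div_mul_div_comm, one_le_div (by positivity)]
    nlinarith
  rw [eLpNorm_eq_lintegral_rpow_enorm_toReal hP' ENNReal.ofReal_ne_top,
    eLpNorm_eq_lintegral_rpow_enorm_toReal hP' ENNReal.ofReal_ne_top,
    ENNReal.toReal_ofReal hP0.le, ← ENNReal.mul_rpow_of_nonneg _ _ (by positivity)]
  gcongr

/-- The closed shells decrease to a sphere, which is a null set. This makes the error of smoothing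
the reflected extension disappear. -/
theorem tendsto_volume_shell (N : ℕ) {T : ℝ} (hT : 0 < T) :
    Tendsto (fun n : ℕ => volume {x : EuclideanSpace ℝ (Fin N) | T ≤ ‖x‖ ∧ ‖x‖ ≤ T + 1 / (n + 1)})
      atTop (𝓝 0) := by
  have hcl : ∀ n : ℕ, IsClosed
      {x : EuclideanSpace ℝ (Fin N) | T ≤ ‖x‖ ∧ ‖x‖ ≤ T + 1 / ((n : ℝ) + 1)} := fun n =>
    (isClosed_le continuous_const continuous_norm).inter
      (isClosed_le continuous_norm continuous_const)
  have h := tendsto_measure_iInter_atTop (μ := (volume : Measure (EuclideanSpace ℝ (Fin N))))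
    (s := fun n : ℕ => {x : EuclideanSpace ℝ (Fin N) | T ≤ ‖x‖ ∧ ‖x‖ ≤ T + 1 / ((n : ℝ) + 1)})
    (fun n => (hcl n).measurableSet.nullMeasurableSet)
    (fun m n hmn x hx => ⟨hx.1, hx.2.trans (by gcongr)⟩)
    ⟨0, ((Metric.isBounded_closedBall (x := (0 : EuclideanSpace ℝ (Fin N)))
      (r := T + 1)).subset fun x hx => by
        have := hx.2
        simp only [Nat.cast_zero, zero_add, div_one] at this
        simpa using this).measure_lt_top.ne⟩
  have hsph : (⋂ n : ℕ, {x : EuclideanSpace ℝ (Fin N) | T ≤ ‖x‖ ∧ ‖x‖ ≤ T + 1 / ((n : ℝ) + 1)}) =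
      Metric.sphere 0 T := by
    ext x
    simp only [Set.mem_iInter, Set.mem_ofPred_eq, mem_sphere_zero_iff_norm]
    constructor
    · intro hx
      refine le_antisymm ?_ (hx 0).1
      have hlim : Tendsto (fun n : ℕ => T + 1 / ((n : ℝ) + 1)) atTop (𝓝 (T + 0)) :=
        tendsto_const_nhds.add tendsto_one_div_add_atTop_nhds_zero_nat
      simpa using ge_of_tendsto' hlim fun n => (hx n).2
    · intro hx n
      rw [hx]
      exact ⟨le_rfl, by simp; positivity⟩
  rw [hsph, Measure.addHaar_sphere_of_ne_zero _ _ hT.ne'] at h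
  exact h

end Inversion

/-! ### Sobolev's inequality without a condition on the outer sphere -/

/-- Sobolev's inequality on an annulus for functions that vanish near the inner boundary only. -/
theorem exists_eLpNorm_annulus_le_eLpNorm_fderiv {N : ℕ} (hN : 1 ≤ N) {r T : ℝ} (hr : 0 < r)
    (hrT : r < T) {P Q : ℝ} (hP : 1 ≤ P) (hQ : 1 ≤ Q) (hPQ : P < N → 1 / P - 1 / N ≤ 1 / Q) :
    ∃ C : NNReal, ∀ φ : EuclideanSpace ℝ (Fin N) → ℝ, ContDiff ℝ 1 φ → HasCompactSupport φ →
      (∀ x ∈ tsupport φ, r < ‖x‖) →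
      eLpNorm φ (ENNReal.ofReal Q) (volume.restrict (annulus N r (T : EReal))) ≤
        C * eLpNorm (fderiv ℝ φ) (ENNReal.ofReal P)
          (volume.restrict (annulus N r (T : EReal))) := by
  have hT : 0 < T := hr.trans hrT
  have hP0 : 0 < P := by linarith
  -- The radius accommodates the reflected function, which vanishes from `T² / r` on, and the
  -- transition shells, which end before `T + 1`.
  obtain ⟨C, hC⟩ := exists_eLpNorm_le_eLpNorm_fderiv hN
    (Metric.isBounded_closedBall (x := (0 : EuclideanSpace ℝ (Fin N))) (r := T ^ 2 / r + T + 1))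
    hP hQ hPQ
  obtain ⟨D, hD, hcut⟩ := exists_radial_cutoff (EuclideanSpace ℝ (Fin N))
  set k : ℝ≥0∞ := ENNReal.ofReal ((T / r) ^ (2 * N)) ^ (1 / P) with hk
  have hkt : k ≠ ∞ := ENNReal.rpow_ne_top_of_nonneg (by positivity) ENNReal.ofReal_ne_top
  refine ⟨C * (1 + k.toNNReal), fun φ h1 h2 hφ => ?_⟩
  set A := annulus N r (T : EReal) with hA
  have hAm : MeasurableSet A := measurableSet_annulus _ _ _
  have hφ0 : ∀ x, ‖x‖ ≤ r → φ x = 0 := fun x hx => by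
    by_contra hne
    exact absurd (hφ x (subset_tsupport φ hne)) (not_lt.2 hx)
  have hdφ0 : ∀ x, ‖x‖ ≤ r → fderiv ℝ φ x = 0 := fun x hx => by
    by_contra hne
    exact absurd (hφ x (support_fderiv_subset ℝ hne)) (not_lt.2 hx)
  obtain ⟨K, hK⟩ := h1.lipschitzWith_of_hasCompactSupport h2 one_ne_zero
  have hKd : ∀ x, ‖fderiv ℝ φ x‖ ≤ K := fun x => norm_fderiv_le_of_lipschitz ℝ hK
  set ψ : EuclideanSpace ℝ (Fin N) → ℝ := fun x => φ (EuclideanGeometry.inversion 0 T x) with hψ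
  have hψ1 : ContDiff ℝ 1 ψ := contDiff_comp_inversion hT h1 h2 (hφ0 0 (by simpa using hr.le))
  have hψd : ∀ x, T ≤ ‖x‖ → ‖fderiv ℝ ψ x‖ ≤ K := fun x hx => by
    have hx0 : 0 < ‖x‖ := hT.trans_le hx
    refine (norm_fderiv_comp_inversion_le h1 (norm_pos_iff.1 hx0)).trans ?_
    refine (mul_le_of_le_one_left (norm_nonneg _) (pow_le_one₀ (by positivity) ?_)).trans (hKd _)
    exact (div_le_one hx0).2 hx
  -- Bound for the gradient of the glued function on the shell: `K` from `∇ψ`, `2K` from `η (∇φ -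
  -- ∇ψ)`, and `2Kδ · D/δ` from `(φ - ψ) ∇η`. It depends on `φ` but not on the width `δ`.
  set M : ℝ := K * (3 + 2 * D) with hM
  have hM0 : 0 ≤ M := by positivity
  set shell : ℕ → Set (EuclideanSpace ℝ (Fin N)) :=
    fun n => {x | T ≤ ‖x‖ ∧ ‖x‖ ≤ T + 1 / ((n : ℝ) + 1)} with hshell
  have hshm : ∀ n, MeasurableSet (shell n) := fun n =>
    ((isClosed_le continuous_const continuous_norm).inter
      (isClosed_le continuous_norm continuous_const)).measurableSet
  have hOm : MeasurableSet {x : EuclideanSpace ℝ (Fin N) | T < ‖x‖} :=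
    (isOpen_lt continuous_const continuous_norm).measurableSet
  have key : ∀ n : ℕ, eLpNorm φ (ENNReal.ofReal Q) (volume.restrict A) ≤
      C * ((1 + k) * eLpNorm (fderiv ℝ φ) (ENNReal.ofReal P) (volume.restrict A) +
        ‖M‖ₑ * volume (shell n) ^ (1 / P)) := by
    intro n
    set δ : ℝ := 1 / ((n : ℝ) + 1) with hδ
    have hδ0 : 0 < δ := by positivity
    have hδ1 : δ ≤ 1 := by
      rw [hδ, div_le_one (by positivity)]; have : (0 : ℝ) ≤ n := n.cast_nonneg; linarith
    obtain ⟨η, hη, hη0, hη1, hηa, hηb, hηd⟩ := hcut T (T + δ) hT (by linarith)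
    -- A `C¹` gluing: `φ` inside the sphere and its reflection `ψ` beyond the shell of width `δ`.
    -- The plain reflected extension is only Lipschitz across the sphere.
    set f : EuclideanSpace ℝ (Fin N) → ℝ := fun x => ψ x + η x * (φ x - ψ x) with hf
    have hf1 : ContDiff ℝ 1 f := hψ1.add ((hη.of_le (by simp)).mul (h1.sub hψ1))
    have hfs : Function.support f ⊆ Metric.closedBall 0 (T ^ 2 / r + T + 1) := by
      intro x hx
      by_contra hne
      rw [mem_closedBall_zero_iff, not_le] at hne
      apply hx
      have h3 : 0 < T ^ 2 / r := by positivity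
      have h4 : η x = 0 := hηb x (by linarith)
      have h5 : ψ x = 0 := by
        apply hφ0
        rw [norm_inversion_zero, div_le_iff₀ (by linarith)]
        have : T ^ 2 / r * r = T ^ 2 := by field_simp
        nlinarith
      simp [hf, h4, h5]
    have hfA : eLpNorm φ (ENNReal.ofReal Q) (volume.restrict A) ≤
        eLpNorm f (ENNReal.ofReal Q) volume := by
      refine le_trans (eLpNorm_congr_ae ?_).le (eLpNorm_mono_measure f Measure.restrict_le_self)
      filter_upwards [ae_restrict_mem hAm] with x hx
      simp [hf, hηa x (mem_annulus_coe.1 hx).2.le]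
    have hdf : ∀ x, ‖fderiv ℝ f x‖ ≤ (A.indicator (fun x => ‖fderiv ℝ φ x‖) x +
        {x | T < ‖x‖}.indicator (fun x => ‖fderiv ℝ ψ x‖) x) +
        (shell n).indicator (fun _ => M) x := by
      intro x
      have hi1 : 0 ≤ A.indicator (fun x => ‖fderiv ℝ φ x‖) x :=
        Set.indicator_nonneg (fun _ _ => norm_nonneg _) _
      have hi2 : 0 ≤ {x | T < ‖x‖}.indicator (fun x => ‖fderiv ℝ ψ x‖) x :=
        Set.indicator_nonneg (fun _ _ => norm_nonneg _) _
      have hi3 : 0 ≤ (shell n).indicator (fun _ => M) x :=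
        Set.indicator_nonneg (fun _ _ => hM0) _
      rcases lt_or_ge ‖x‖ T with hx | hx
      · have h3 : f =ᶠ[𝓝 x] φ := by
          filter_upwards [continuous_norm.continuousAt.eventually (Iio_mem_nhds hx)] with y hy
          simp [hf, hηa y (le_of_lt hy)]
        have h4 : ‖fderiv ℝ φ x‖ ≤ A.indicator (fun x => ‖fderiv ℝ φ x‖) x := by
          rcases le_or_gt ‖x‖ r with hxr | hxr
          · rw [hdφ0 x hxr, norm_zero]; exact hi1
          · rw [Set.indicator_of_mem (mem_annulus_coe.2 ⟨hxr, hx⟩)]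
        rw [h3.fderiv_eq]
        linarith
      rcases lt_or_ge (T + δ) ‖x‖ with hx2 | hx2
      · have h3 : f =ᶠ[𝓝 x] ψ := by
          filter_upwards [continuous_norm.continuousAt.eventually (Ioi_mem_nhds hx2)] with y hy
          simp [hf, hηb y (le_of_lt hy)]
        have h4 : {x | T < ‖x‖}.indicator (fun x => ‖fderiv ℝ ψ x‖) x = ‖fderiv ℝ ψ x‖ :=
          Set.indicator_of_mem (s := {x : EuclideanSpace ℝ (Fin N) | T < ‖x‖})
            (lt_of_le_of_lt (by linarith) hx2 : T < ‖x‖) _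
        rw [h3.fderiv_eq]
        linarith
      · rw [Set.indicator_of_mem (show x ∈ shell n from ⟨hx, hx2⟩)]
        have hdφ := (h1.differentiable one_ne_zero).differentiableAt (x := x)
        have hdψ := (hψ1.differentiable one_ne_zero).differentiableAt (x := x)
        have hdη := (hη.differentiable (by simp)).differentiableAt (x := x)
        have h3 : fderiv ℝ f x = _ :=
          (hdψ.hasFDerivAt.add (hdη.hasFDerivAt.mul (hdφ.hasFDerivAt.sub hdψ.hasFDerivAt))).fderiv
        have h4 : ‖φ x - ψ x‖ ≤ K * (2 * δ) := by
          refine (hK.norm_sub_le _ _).trans ?_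
          gcongr
          refine (norm_sub_inversion_zero hT hx).trans ?_
          linarith
        have h5 : ‖fderiv ℝ f x‖ ≤ K + (1 * (K + K) + K * (2 * δ) * (D / (T + δ - T))) := by
          rw [h3]
          refine (norm_add_le _ _).trans (add_le_add (hψd x hx) ((norm_add_le _ _).trans
            (add_le_add ?_ ?_)))
          · rw [norm_smul, Real.norm_of_nonneg (hη0 x)]
            refine mul_le_mul (hη1 x) ((norm_sub_le _ _).trans (add_le_add (hKd x) (hψd x hx)))
              (norm_nonneg _) zero_le_one
          · rw [norm_smul]
            exact mul_le_mul h4 (hηd x) (norm_nonneg _) (by positivity)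
        have h6 : K + (1 * (K + K) + K * (2 * δ) * (D / (T + δ - T))) = M := by
          rw [add_sub_cancel_left, hM]; field_simp; ring
        linarith
    have hmφ : AEStronglyMeasurable (fun x => ‖fderiv ℝ φ x‖) volume :=
      (h1.continuous_fderiv one_ne_zero).norm.aestronglyMeasurable
    have hmψ : AEStronglyMeasurable (fun x => ‖fderiv ℝ ψ x‖) volume :=
      (hψ1.continuous_fderiv one_ne_zero).norm.aestronglyMeasurable
    have hP1 : 1 ≤ ENNReal.ofReal P := by simpa using hP
    refine (hfA.trans (hC f hf1 hfs)).trans ?_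
    gcongr
    refine (eLpNorm_mono_real hdf).trans ((eLpNorm_add_le ((hmφ.indicator hAm).add
      (hmψ.indicator hOm)) (aestronglyMeasurable_const.indicator (hshm n)) hP1).trans ?_)
    refine add_le_add ((eLpNorm_add_le (hmφ.indicator hAm) (hmψ.indicator hOm) hP1).trans ?_) ?_
    · rw [eLpNorm_indicator_eq_eLpNorm_restrict hAm, eLpNorm_indicator_eq_eLpNorm_restrict hOm,
        eLpNorm_norm, eLpNorm_norm, add_mul, one_mul]
      gcongr
      exact eLpNorm_fderiv_comp_inversion_le hr hrT hP h1 hφ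
    · refine (eLpNorm_indicator_const_le _ _).trans ?_
      rw [ENNReal.toReal_ofReal hP0.le]
  have hlim : Tendsto (fun n : ℕ => (C : ℝ≥0∞) *
      ((1 + k) * eLpNorm (fderiv ℝ φ) (ENNReal.ofReal P) (volume.restrict A) +
        ‖M‖ₑ * volume (shell n) ^ (1 / P))) atTop
      (𝓝 (C * ((1 + k) * eLpNorm (fderiv ℝ φ) (ENNReal.ofReal P) (volume.restrict A) +
        ‖M‖ₑ * 0 ^ (1 / P)))) := by
    refine ENNReal.Tendsto.const_mul (tendsto_const_nhds.add (ENNReal.Tendsto.const_mul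
      ((ENNReal.continuous_rpow_const.tendsto 0).comp (tendsto_volume_shell N hT)) ?_)) ?_
    · exact Or.inr enorm_ne_top
    · exact Or.inr ENNReal.coe_ne_top
  have := ge_of_tendsto' hlim key
  rw [ENNReal.zero_rpow_of_pos (by positivity), mul_zero, add_zero, ← mul_assoc] at this
  rwa [ENNReal.coe_mul, ENNReal.coe_add, ENNReal.coe_one, ENNReal.coe_toNNReal hkt]

/-! ### Hölder inequalities with weights -/

section Weights

variable {α : Type*} [MeasurableSpace α] {μ : Measure α} {F : Type*} [NormedAddCommGroup F]

theorem ofReal_mul_norm_rpow_eq {a p : ℝ} (ha : 0 ≤ a) (hp : 0 ≤ p) (y : F) :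
    ENNReal.ofReal (a * ‖y‖ ^ p) = ENNReal.ofReal a * ‖y‖ₑ ^ p := by
  rw [ENNReal.ofReal_mul ha, ← ENNReal.ofReal_rpow_of_nonneg (norm_nonneg _) hp, ofReal_norm]

theorem lintegral_ofReal_mul_norm_rpow_eq {L : α → ℝ} (hL : AEMeasurable L μ)
    (hL0 : ∀ᵐ x ∂μ, 0 ≤ L x) {p : ℝ} (hp : 0 < p) {V : α → F} (hV : AEStronglyMeasurable V μ) :
    ∫⁻ x, ENNReal.ofReal (L x * ‖V x‖ ^ p) ∂μ =
      eLpNorm V (ENNReal.ofReal p) (μ.withDensity fun x => ENNReal.ofReal (L x)) ^ p := by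
  rw [eLpNorm_eq_lintegral_rpow_enorm_toReal (by simpa using hp) ENNReal.ofReal_ne_top,
    ENNReal.toReal_ofReal hp.le, ← ENNReal.rpow_mul, one_div, inv_mul_cancel₀ hp.ne',
    ENNReal.rpow_one, lintegral_withDensity_eq_lintegral_mul₀ hL.ennreal_ofReal
      (hV.enorm.pow_const p)]
  refine lintegral_congr_ae ?_
  filter_upwards [hL0] with x hx
  rw [ofReal_mul_norm_rpow_eq hx hp.le]; rfl

/-- Embedding of a weighted Lebesgue space with weight `L`, `L⁻ˢ` integrable, into a plain one. -/
theorem exists_eLpNorm_le_eLpNorm_withDensity {L : α → ℝ} (hL : AEMeasurable L μ)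
    (hL0 : ∀ᵐ x ∂μ, 0 < L x) {p s : ℝ} (hp : 0 < p) (hs : 0 < s)
    (hLs : Integrable (fun x => L x ^ (-s)) μ) :
    ∃ C : NNReal, ∀ V : α → F, AEStronglyMeasurable V μ →
      eLpNorm V (ENNReal.ofReal (pSub p s)) μ ≤
        C * eLpNorm V (ENNReal.ofReal p) (μ.withDensity fun x => ENNReal.ofReal (L x)) := by
  have hps : 0 < pSub p s := by unfold pSub; positivity
  set I := ∫⁻ x, ENNReal.ofReal (L x ^ (-s)) ∂μ with hI
  have hIt : I ≠ ∞ := (hLs.lintegral_lt_top).ne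
  have hIt' : I ^ (1 / (p * s)) ≠ ∞ := ENNReal.rpow_ne_top_of_nonneg (by positivity) hIt
  refine ⟨(I ^ (1 / (p * s))).toNNReal, fun V hV => ?_⟩
  rw [ENNReal.coe_toNNReal hIt', eLpNorm_eq_lintegral_rpow_enorm_toReal (by simpa using hps)
    ENNReal.ofReal_ne_top, ENNReal.toReal_ofReal hps.le]
  -- Hölder's inequality for the factorisation `|V|^{p_s} = (L⁻ˢ)^{1/(s+1)} (L |V|^p)^{s/(s+1)}`.
  have h1 : ∫⁻ x, ‖V x‖ₑ ^ pSub p s ∂μ ≤ I ^ (1 / (s + 1)) *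
      (∫⁻ x, ENNReal.ofReal (L x) * ‖V x‖ₑ ^ p ∂μ) ^ (s / (s + 1)) := by
    refine le_trans (lintegral_mono_ae ?_) (ENNReal.lintegral_mul_norm_pow_le
      (hL.pow_const (-s)).ennreal_ofReal (hL.ennreal_ofReal.mul (hV.enorm.pow_const p))
      (by positivity) (by positivity) (by field_simp; ring))
    filter_upwards [hL0] with x hx
    rw [← ENNReal.ofReal_rpow_of_pos hx, ← ENNReal.rpow_mul, Pi.mul_apply,
      ENNReal.mul_rpow_of_nonneg _ _ (by positivity), ← ENNReal.rpow_mul, ← mul_assoc,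
      ← ENNReal.rpow_add _ _ (by simpa using hx) ENNReal.ofReal_ne_top]
    have h2 : -s * (1 / (s + 1)) + s / (s + 1) = 0 := by ring
    have h3 : p * (s / (s + 1)) = pSub p s := by unfold pSub; ring
    rw [h2, h3]; simp
  calc (∫⁻ x, ‖V x‖ₑ ^ pSub p s ∂μ) ^ (1 / pSub p s) ≤ (I ^ (1 / (s + 1)) *
      (∫⁻ x, ENNReal.ofReal (L x) * ‖V x‖ₑ ^ p ∂μ) ^ (s / (s + 1))) ^ (1 / pSub p s) := by
        gcongr
    _ = _ := by
        rw [ENNReal.mul_rpow_of_nonneg _ _ (by positivity), ← ENNReal.rpow_mul, ← ENNReal.rpow_mul]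
        have h2 : 1 / (s + 1) * (1 / pSub p s) = 1 / (p * s) := by unfold pSub; field_simp
        have h3 : s / (s + 1) * (1 / pSub p s) = 1 / p := by unfold pSub; field_simp
        rw [h2, h3]
        congr 1
        rw [eLpNorm_eq_lintegral_rpow_enorm_toReal (by simpa using hp) ENNReal.ofReal_ne_top,
          ENNReal.toReal_ofReal hp.le, lintegral_withDensity_eq_lintegral_mul₀ hL.ennreal_ofReal
          (hV.enorm.pow_const p)]
        rfl

/-- This is `(q - p)/q + p/q = 1`, in extended exponents so that `q = p` is covered with the
exponent `∞`. -/
theorem holderTriple_weightExp {p q : ℝ} (hp : 0 < p) (hpq : p ≤ q) :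
    (weightExp p q).HolderTriple (ENNReal.ofReal (q / p)) 1 := by
  have hq : 0 < q := hp.trans_le hpq
  constructor
  rw [weightExp, ENNReal.inv_div (Or.inl ENNReal.ofReal_ne_top) (Or.inr (by simpa using hq)),
    ← ENNReal.ofReal_div_of_pos hq, ← ENNReal.ofReal_inv_of_pos (by positivity),
    ← ENNReal.ofReal_add (div_nonneg (by linarith) hq.le) (by positivity), inv_one,
    ← ENNReal.ofReal_one]
  congr 1
  field_simp
  ring

/-- Hölder's inequality for `∫ |W| |g|^p` with `W ∈ L^(q/(q-p))` and `g ∈ L^q`. -/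
theorem lintegral_enorm_mul_rpow_le {W : α → ℝ} (hW : AEStronglyMeasurable W μ) {p q : ℝ}
    (hp : 0 < p) (hpq : p ≤ q) {g : α → F} (hg : AEStronglyMeasurable g μ) :
    ∫⁻ x, ‖W x‖ₑ * ‖g x‖ₑ ^ p ∂μ ≤
      eLpNorm W (weightExp p q) μ * eLpNorm g (ENNReal.ofReal q) μ ^ p := by
  have := holderTriple_weightExp hp hpq
  have hg' : AEStronglyMeasurable (fun x => ‖g x‖ ^ p) μ :=
    (hg.norm.aemeasurable.pow_const p).aestronglyMeasurable
  have h := eLpNorm_smul_le_mul_eLpNorm (p := weightExp p q) (q := ENNReal.ofReal (q / p)) (r := 1)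
    hg' hW
  rw [eLpNorm_norm_rpow _ hp, ← ENNReal.ofReal_mul (by have := hp.trans_le hpq; positivity),
    div_mul_cancel₀ _ hp.ne', eLpNorm_one_eq_lintegral_enorm] at h
  refine le_trans (le_of_eq (lintegral_congr fun x => ?_)) h
  rw [Pi.smul_apply', smul_eq_mul, enorm_mul, Real.enorm_rpow_of_nonneg (norm_nonneg _) hp.le,
    enorm_norm]

theorem withDensity_restrict_le {A B : Set α} (hA : MeasurableSet A)
    (hAB : A ⊆ B) (f : α → ℝ≥0∞) :
    (μ.restrict A).withDensity f ≤ (μ.restrict B).withDensity f := by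
  rw [← Set.inter_eq_left.2 hAB, ← Measure.restrict_restrict hA, ← restrict_withDensity hA]
  exact Measure.restrict_le_self

end Weights

/-! ### The weighted Sobolev inequality -/

theorem norm_gradient_eq {N : ℕ} (φ : EuclideanSpace ℝ (Fin N) → ℝ)
    (x : EuclideanSpace ℝ (Fin N)) : ‖gradient φ x‖ = ‖fderiv ℝ φ x‖ := by
  simp [gradient]

theorem eLpNorm_gradient_eq {N : ℕ} (φ : EuclideanSpace ℝ (Fin N) → ℝ) (p : ℝ≥0∞)
    (μ : Measure (EuclideanSpace ℝ (Fin N))) :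
    eLpNorm (gradient φ) p μ = eLpNorm (fderiv ℝ φ) p μ :=
  eLpNorm_congr_norm_ae (Eventually.of_forall fun x => norm_gradient_eq φ x)

theorem ContDiff.continuous_gradient {N : ℕ} {φ : EuclideanSpace ℝ (Fin N) → ℝ}
    (h : ContDiff ℝ 1 φ) : Continuous (gradient φ) :=
  (LinearIsometryEquiv.continuous _).comp (h.continuous_fderiv one_ne_zero)

/-- The weighted Sobolev inequality near the inner boundary, with an exponent beyond `q`. -/
theorem exists_weighted_sobolev {N : ℕ} (hN : 1 ≤ N) {p : ℝ} (hp : 1 < p) {r T : ℝ} (hr : 0 < r)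
    (hrT : r < T) {R : EReal} (hTR : (T : EReal) ≤ R) {L : EuclideanSpace ℝ (Fin N) → ℝ}
    (hLm : AEMeasurable L (volume.restrict (annulus N r R)))
    (hLpos : ∀ᵐ x ∂(volume.restrict (annulus N r R)), 0 < L x)
    {s : ℝ} (hs : 1 / (p - 1) ≤ s) {q : ℝ} (hpq : p ≤ q)
    (hq : (q : EReal) < sobolevExp N (pSub p s))
    (hLs : IntegrableOn (fun x => L x ^ (-s)) (annulus N r (T : EReal))) :
    ∃ Q : ℝ, q < Q ∧ ∃ S : NNReal, ∀ φ, IsC1c (annulus N r R) φ →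
      eLpNorm φ (ENNReal.ofReal Q) (volume.restrict (annulus N r (T : EReal))) ≤
        S * eLpNorm (gradient φ) (ENNReal.ofReal p)
          ((volume.restrict (annulus N r R)).withDensity fun x => ENNReal.ofReal (L x)) := by
  have hp0 : 0 < p - 1 := by linarith
  have hs0 : 0 < s := lt_of_lt_of_le (by positivity) hs
  have hps : 1 ≤ pSub p s := by
    rw [div_le_iff₀ hp0] at hs
    rw [pSub, le_div_iff₀ (by linarith)]; linarith
  have hsub := annulus_subset_annulus (N := N) (a := r) hTR
  obtain ⟨C, hC⟩ := exists_eLpNorm_le_eLpNorm_withDensity (F := EuclideanSpace ℝ (Fin N))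
    (hLm.mono_measure (Measure.restrict_mono_set volume hsub))
    (ae_mono (Measure.restrict_mono_set volume hsub) hLpos)
    (by linarith : 0 < p) hs0 hLs
  obtain ⟨Q, hqQ, hQ⟩ : ∃ Q : ℝ, q < Q ∧ (pSub p s < N → 1 / pSub p s - 1 / N ≤ 1 / Q) := by
    by_cases h : pSub p s < N
    · rw [sobolevExp, if_pos h, EReal.coe_lt_coe_iff] at hq
      -- `Q` is `p_s^*` itself, at which the Sobolev condition holds with equality. When `p_s ≥ N`
      -- any finite exponent serves, and `q + 1` is taken.
      refine ⟨_, hq, fun _ => le_of_eq ?_⟩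
      have h1 : (N : ℝ) ≠ 0 := by positivity
      have h2 : pSub p s ≠ 0 := by linarith
      field_simp
    · exact ⟨q + 1, by linarith, fun h' => absurd h' h⟩
  obtain ⟨C', hC'⟩ := exists_eLpNorm_annulus_le_eLpNorm_fderiv hN hr hrT hps
    (by linarith : (1 : ℝ) ≤ Q) hQ
  refine ⟨Q, hqQ, C' * C, fun φ hφ => ?_⟩
  refine (hC' φ hφ.contDiff hφ.hasCompactSupport fun x hx => (hφ.tsupport_subset hx).1).trans ?_
  rw [ENNReal.coe_mul, mul_assoc, ← eLpNorm_gradient_eq]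
  gcongr
  refine (hC _ hφ.contDiff.continuous_gradient.aestronglyMeasurable).trans ?_
  gcongr
  exact withDensity_restrict_le (measurableSet_annulus _ _ _) hsub _

/-! ### The weighted setting and approximation by test functions -/

/-- The measure `L dx` on the annulus `r < |x| < R`. -/
noncomputable def weightedVolume (N : ℕ) (r : ℝ) (R : EReal) (L : EuclideanSpace ℝ (Fin N) → ℝ) :
    Measure (EuclideanSpace ℝ (Fin N)) :=
  (volume.restrict (annulus N r R)).withDensity fun x => ENNReal.ofReal (L x)

/-- The assumptions on the weight `L` on `r < |x| < R` that are used near the inner boundary, on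
`r < |x| < T`. -/
structure AdmissibleWeight (N : ℕ) (p q s r T : ℝ) (R : EReal)
    (L : EuclideanSpace ℝ (Fin N) → ℝ) : Prop where
  one_lt : 1 < p
  le_q : p ≤ q
  s_ge : 1 / (p - 1) ≤ s
  r_pos : 0 < r
  r_lt : r < T
  T_lt : (T : EReal) < R
  aemeasurable : AEMeasurable L (volume.restrict (annulus N r R))
  pos : ∀ᵐ x ∂(volume.restrict (annulus N r R)), 0 < L x
  locallyIntegrableOn : LocallyIntegrableOn L (annulus N r R)
  integrableOn_rpow_neg : IntegrableOn (fun x => L x ^ (-s)) (annulus N r (T : EReal))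
  memLp : MemLp L (weightExp p q) (volume.restrict (annulus N r (T : EReal)))

/-- Sobolev's inequality with exponent `Q` on `r < |x| < T`, for test functions on `r < |x| < R`. -/
def SobolevBound (N : ℕ) (p r T : ℝ) (R : EReal) (L : EuclideanSpace ℝ (Fin N) → ℝ) (Q : ℝ)
    (S : NNReal) : Prop :=
  ∀ φ, IsC1c (annulus N r R) φ →
    eLpNorm φ (ENNReal.ofReal Q) (volume.restrict (annulus N r (T : EReal))) ≤
      S * eLpNorm (gradient φ) (ENNReal.ofReal p) (weightedVolume N r R L)

/-- `φ n ∈ C_c^1(Ω)` converge to `u` locally in `L^1`, and their gradients to `G` in `L^p(Ω; L)`. -/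
structure IsApprox (N : ℕ) (p r : ℝ) (R : EReal) (L : EuclideanSpace ℝ (Fin N) → ℝ)
    (u : EuclideanSpace ℝ (Fin N) → ℝ) (G : EuclideanSpace ℝ (Fin N) → EuclideanSpace ℝ (Fin N))
    (φ : ℕ → EuclideanSpace ℝ (Fin N) → ℝ) : Prop where
  isC1c : ∀ n, IsC1c (annulus N r R) (φ n)
  tendsto_local : ∀ S : Set (EuclideanSpace ℝ (Fin N)), IsCompact S → S ⊆ annulus N r R →
    Tendsto (fun n => ∫⁻ x in S, ‖φ n x - u x‖ₑ) atTop (𝓝 0)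
  tendsto_grad : Tendsto (fun n => eLpNorm (gradient (φ n) - G) (ENNReal.ofReal p)
    (weightedVolume N r R L)) atTop (𝓝 0)

theorem weightedVolume_absolutelyContinuous (N : ℕ) (r : ℝ) (R : EReal)
    (L : EuclideanSpace ℝ (Fin N) → ℝ) :
    weightedVolume N r R L ≪ volume.restrict (annulus N r R) :=
  withDensity_absolutelyContinuous _ _

theorem HasWeakGradient.aestronglyMeasurable {N : ℕ} {Ω : Set (EuclideanSpace ℝ (Fin N))}
    {u : EuclideanSpace ℝ (Fin N) → ℝ} {G : EuclideanSpace ℝ (Fin N) → EuclideanSpace ℝ (Fin N)}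
    (h : HasWeakGradient Ω u G) : AEStronglyMeasurable u (volume.restrict Ω) :=
  h.locallyIntegrableOn.aestronglyMeasurable

theorem HasWeakGradient.aestronglyMeasurable_grad {N : ℕ} {Ω : Set (EuclideanSpace ℝ (Fin N))}
    {u : EuclideanSpace ℝ (Fin N) → ℝ} {G : EuclideanSpace ℝ (Fin N) → EuclideanSpace ℝ (Fin N)}
    (h : HasWeakGradient Ω u G) : AEStronglyMeasurable G (volume.restrict Ω) :=
  h.locallyIntegrableOn_grad.aestronglyMeasurable

namespace IsC1c

variable {N : ℕ} {Ω : Set (EuclideanSpace ℝ (Fin N))} {φ ψ : EuclideanSpace ℝ (Fin N) → ℝ}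

theorem differentiableAt (h : IsC1c Ω φ) (x : EuclideanSpace ℝ (Fin N)) :
    DifferentiableAt ℝ φ x :=
  (h.contDiff.differentiable one_ne_zero).differentiableAt

theorem sub (h : IsC1c Ω φ) (h' : IsC1c Ω ψ) : IsC1c Ω (φ - ψ) where
  contDiff := h.contDiff.sub h'.contDiff
  hasCompactSupport := h.hasCompactSupport.sub h'.hasCompactSupport
  tsupport_subset := (tsupport_sub φ ψ).trans (Set.union_subset h.tsupport_subset
    h'.tsupport_subset)

theorem gradient_sub (h : IsC1c Ω φ) (h' : IsC1c Ω ψ) :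
    gradient (φ - ψ) = gradient φ - gradient ψ := by
  ext1 x
  simp [gradient, fderiv_sub (h.differentiableAt x) (h'.differentiableAt x)]

end IsC1c

namespace AdmissibleWeight

variable {N : ℕ} {p q s r T : ℝ} {R : EReal} {L : EuclideanSpace ℝ (Fin N) → ℝ}
  {u : EuclideanSpace ℝ (Fin N) → ℝ} {G : EuclideanSpace ℝ (Fin N) → EuclideanSpace ℝ (Fin N)}
  {φ : ℕ → EuclideanSpace ℝ (Fin N) → ℝ}

theorem p_pos (hL : AdmissibleWeight N p q s r T R L) : 0 < p := zero_lt_one.trans hL.one_lt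

theorem q_pos (hL : AdmissibleWeight N p q s r T R L) : 0 < q := hL.p_pos.trans_le hL.le_q

theorem annulus_subset (hL : AdmissibleWeight N p q s r T R L) :
    annulus N r (T : EReal) ⊆ annulus N r R := annulus_subset_annulus hL.T_lt.le

theorem restrict_le (hL : AdmissibleWeight N p q s r T R L) :
    (volume : Measure (EuclideanSpace ℝ (Fin N))).restrict (annulus N r (T : EReal)) ≤
      volume.restrict (annulus N r R) :=
  Measure.restrict_mono_set volume hL.annulus_subset

/-- `L^p(Ω; L) ⊆ L^1` near the inner boundary. -/
theorem exists_eLpNorm_one_le (hL : AdmissibleWeight N p q s r T R L) :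
    ∃ C : NNReal, ∀ V : EuclideanSpace ℝ (Fin N) → EuclideanSpace ℝ (Fin N),
      AEStronglyMeasurable V (volume.restrict (annulus N r R)) →
      eLpNorm V 1 (volume.restrict (annulus N r (T : EReal))) ≤
        C * eLpNorm V (ENNReal.ofReal p) (weightedVolume N r R L) := by
  have hp0 : 0 < p - 1 := by linarith [hL.one_lt]
  have hs := hL.s_ge
  have hs0 : 0 < s := lt_of_lt_of_le (by positivity) hs
  have hps : 1 ≤ pSub p s := by
    rw [div_le_iff₀ hp0] at hs
    rw [pSub, le_div_iff₀ (by linarith)]; linarith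
  obtain ⟨C, hC⟩ := exists_eLpNorm_le_eLpNorm_withDensity (F := EuclideanSpace ℝ (Fin N))
    (hL.aemeasurable.mono_measure hL.restrict_le) (ae_mono hL.restrict_le hL.pos) hL.p_pos hs0
    hL.integrableOn_rpow_neg
  have hfin : volume (annulus N r (T : EReal)) ^
      (1 / (1 : ℝ≥0∞).toReal - 1 / (ENNReal.ofReal (pSub p s)).toReal) ≠ ∞ := by
    refine ENNReal.rpow_ne_top_of_nonneg ?_ (volume_annulus_lt_top N r T).ne
    rw [ENNReal.toReal_ofReal (by linarith), ENNReal.toReal_one, sub_nonneg]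
    exact one_div_le_one_div_of_le one_pos hps
  refine ⟨C * (volume (annulus N r (T : EReal)) ^
      (1 / (1 : ℝ≥0∞).toReal - 1 / (ENNReal.ofReal (pSub p s)).toReal)).toNNReal, fun V hV => ?_⟩
  have h1 := eLpNorm_le_eLpNorm_mul_rpow_measure_univ (p := 1) (q := ENNReal.ofReal (pSub p s))
    (by simpa using hps) (hV.mono_measure hL.restrict_le)
  rw [Measure.restrict_apply_univ] at h1
  rw [ENNReal.coe_mul, ENNReal.coe_toNNReal hfin, mul_right_comm]
  refine h1.trans ?_
  gcongr
  refine (hC V (hV.mono_measure hL.restrict_le)).trans ?_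
  gcongr
  exact withDensity_restrict_le (measurableSet_annulus _ _ _) hL.annulus_subset _

/-- Powers `t^p` and `t^{1/p}` are continuous at `0`, so the integrals and the norms tend to zero
together. The norm form gives access to the triangle inequality. -/
theorem memD0_iff (hL : AdmissibleWeight N p q s r T R L) :
    MemD0 p (annulus N r R) L u G ↔
      HasWeakGradient (annulus N r R) u G ∧ ∃ φ, IsApprox N p r R L u G φ := by
  have key : ∀ φ : ℕ → EuclideanSpace ℝ (Fin N) → ℝ, (∀ n, IsC1c (annulus N r R) (φ n)) →
      HasWeakGradient (annulus N r R) u G →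
      (Tendsto (fun n => ∫⁻ x in annulus N r R,
        ENNReal.ofReal (L x * ‖gradient (φ n) x - G x‖ ^ p)) atTop (𝓝 0) ↔
      Tendsto (fun n => eLpNorm (gradient (φ n) - G) (ENNReal.ofReal p)
        (weightedVolume N r R L)) atTop (𝓝 0)) := by
    intro φ hφ hw
    have h1 : ∀ n, ∫⁻ x in annulus N r R, ENNReal.ofReal (L x * ‖gradient (φ n) x - G x‖ ^ p) =
        eLpNorm (gradient (φ n) - G) (ENNReal.ofReal p) (weightedVolume N r R L) ^ p := fun n =>
      lintegral_ofReal_mul_norm_rpow_eq hL.aemeasurable (hL.pos.mono fun x hx => hx.le) hL.p_pos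
        ((hφ n).contDiff.continuous_gradient.aestronglyMeasurable.sub hw.aestronglyMeasurable_grad)
    simp_rw [h1]
    constructor
    · intro h
      have h2 := (ENNReal.continuous_rpow_const (y := p⁻¹)).tendsto 0 |>.comp h
      rw [ENNReal.zero_rpow_of_pos (inv_pos.2 hL.p_pos)] at h2
      refine h2.congr fun n => ?_
      rw [Function.comp_apply, ← ENNReal.rpow_mul, mul_inv_cancel₀ hL.p_pos.ne', ENNReal.rpow_one]
    · intro h
      have h2 := (ENNReal.continuous_rpow_const (y := p)).tendsto 0 |>.comp h
      rwa [ENNReal.zero_rpow_of_pos hL.p_pos] at h2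
  constructor
  · rintro ⟨hw, φ, h1, h2, h3⟩
    exact ⟨hw, φ, h1, h2, (key φ h1 hw).1 h3⟩
  · rintro ⟨hw, φ, h1, h2, h3⟩
    exact ⟨hw, φ, h1, h2, (key φ h1 hw).2 h3⟩

/-- The Sobolev inequality passes to limits of test functions. -/
theorem eLpNorm_le_of_isApprox (hL : AdmissibleWeight N p q s r T R L) {Q : ℝ} {S : NNReal}
    (hS : SobolevBound N p r T R L Q S)
    (hu : AEStronglyMeasurable u (volume.restrict (annulus N r R)))
    (hG : AEStronglyMeasurable G (volume.restrict (annulus N r R)))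
    (h : IsApprox N p r R L u G φ) :
    eLpNorm u (ENNReal.ofReal Q) (volume.restrict (annulus N r (T : EReal))) ≤
      S * eLpNorm G (ENNReal.ofReal p) (weightedVolume N r R L) := by
  set ν := (volume : Measure (EuclideanSpace ℝ (Fin N))).restrict (annulus N r (T : EReal)) with hν
  have hp1 : 1 ≤ ENNReal.ofReal p := by simpa using hL.one_lt.le
  have hac := weightedVolume_absolutelyContinuous N r R L
  have hGm := hG.mono_ac hac
  -- Local `L¹` convergence is known on compact subsets only, so Fatou's lemma is used twice: on
  -- each `A j` along an a.e. convergent subsequence, then along this exhaustion. Since `T < R`, the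
  -- sets may contain the outer sphere.
  let A : ℕ → Set (EuclideanSpace ℝ (Fin N)) := fun j => {x | r + 1 / ((j : ℝ) + 1) ≤ ‖x‖ ∧ ‖x‖ ≤ T}
  have hAc : ∀ j, IsClosed (A j) := fun j =>
    (isClosed_le continuous_const continuous_norm).inter
      (isClosed_le continuous_norm continuous_const)
  have hAk : ∀ j, IsCompact (A j) := fun j =>
    Metric.isCompact_of_isClosed_isBounded (hAc j)
      ((Metric.isBounded_closedBall (x := (0 : EuclideanSpace ℝ (Fin N))) (r := T)).subset
        fun x hx => by simpa using hx.2)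
  have hAΩ : ∀ j, A j ⊆ annulus N r R := fun j x hx =>
    ⟨lt_of_lt_of_le (by simp; positivity) hx.1, lt_of_le_of_lt (by exact_mod_cast hx.2) hL.T_lt⟩
  have hj : ∀ j, eLpNorm u (ENNReal.ofReal Q) (ν.restrict (A j)) ≤
      S * eLpNorm G (ENNReal.ofReal p) (weightedVolume N r R L) := by
    intro j
    have hle : ν.restrict (A j) ≤ volume.restrict (A j) :=
      Measure.restrict_mono le_rfl Measure.restrict_le_self
    have huA : AEStronglyMeasurable u (volume.restrict (A j)) :=
      hu.mono_measure (Measure.restrict_mono_set volume (hAΩ j))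
    have hmeas : TendstoInMeasure (volume.restrict (A j)) φ atTop u := by
      refine tendstoInMeasure_of_tendsto_eLpNorm (p := 1) one_ne_zero
        (fun n => (h.isC1c n).contDiff.continuous.aestronglyMeasurable) huA ?_
      simp_rw [eLpNorm_one_eq_lintegral_enorm]
      exact h.tendsto_local _ (hAk j) (hAΩ j)
    obtain ⟨ns, hns, hae⟩ := hmeas.exists_seq_tendsto_ae
    have hfat := Lp.eLpNorm_lim_le_liminf_eLpNorm (p := ENNReal.ofReal Q) (μ := ν.restrict (A j))
      (f := fun n => φ (ns n))
      (fun n => (h.isC1c _).contDiff.continuous.aestronglyMeasurable) u (ae_mono hle hae)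
    refine hfat.trans ?_
    have hbd : ∀ n, eLpNorm (φ (ns n)) (ENNReal.ofReal Q) (ν.restrict (A j)) ≤
        S * (eLpNorm (gradient (φ (ns n)) - G) (ENNReal.ofReal p) (weightedVolume N r R L) +
          eLpNorm G (ENNReal.ofReal p) (weightedVolume N r R L)) := by
      intro n
      refine (eLpNorm_mono_measure _ Measure.restrict_le_self).trans ((hS _ (h.isC1c _)).trans ?_)
      gcongr
      have := eLpNorm_add_le (p := ENNReal.ofReal p) (μ := weightedVolume N r R L)
        (((h.isC1c (ns n)).contDiff.continuous_gradient.aestronglyMeasurable).sub hGm) hGm hp1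
      rwa [sub_add_cancel] at this
    have hlim : Tendsto (fun n => S * (eLpNorm (gradient (φ (ns n)) - G) (ENNReal.ofReal p)
        (weightedVolume N r R L) + eLpNorm G (ENNReal.ofReal p) (weightedVolume N r R L))) atTop
        (𝓝 (S * (0 + eLpNorm G (ENNReal.ofReal p) (weightedVolume N r R L)))) :=
      ENNReal.Tendsto.const_mul ((h.tendsto_grad.comp hns.tendsto_atTop).add tendsto_const_nhds)
        (Or.inr ENNReal.coe_ne_top)
    rw [zero_add] at hlim
    calc _ ≤ liminf (fun n => S * (eLpNorm (gradient (φ (ns n)) - G) (ENNReal.ofReal p)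
        (weightedVolume N r R L) + eLpNorm G (ENNReal.ofReal p) (weightedVolume N r R L))) atTop :=
          liminf_le_liminf (Eventually.of_forall hbd)
      _ = _ := hlim.liminf_eq
  have huν : AEStronglyMeasurable u ν := hu.mono_measure hL.restrict_le
  have hfat := Lp.eLpNorm_lim_le_liminf_eLpNorm (p := ENNReal.ofReal Q) (μ := ν)
    (f := fun j => (A j).indicator u) (fun j => huν.indicator (hAc j).measurableSet) u (by
      filter_upwards [ae_restrict_mem (measurableSet_annulus _ _ _)] with x hx
      rw [mem_annulus_coe] at hx
      refine tendsto_const_nhds.congr' ?_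
      have hlim : Tendsto (fun j : ℕ => r + 1 / ((j : ℝ) + 1)) atTop (𝓝 (r + 0)) :=
        tendsto_const_nhds.add tendsto_one_div_add_atTop_nhds_zero_nat
      rw [add_zero] at hlim
      filter_upwards [hlim.eventually (Iio_mem_nhds hx.1)] with j hj
      rw [Set.indicator_of_mem (show x ∈ A j from ⟨le_of_lt hj, hx.2.le⟩)])
  refine hfat.trans ?_
  calc _ ≤ liminf (fun _ : ℕ => S * eLpNorm G (ENNReal.ofReal p) (weightedVolume N r R L)) atTop :=
        liminf_le_liminf (Eventually.of_forall fun j => by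
          show eLpNorm ((A j).indicator u) _ _ ≤ _
          rw [eLpNorm_indicator_eq_eLpNorm_restrict (hAc j).measurableSet]; exact hj j)
    _ = _ := liminf_const _

/-- This shift lets the Sobolev inequality for limits be applied to the error `u - φ k`. -/
theorem isApprox_sub (h : IsApprox N p r R L u G φ) (k : ℕ) :
    IsApprox N p r R L (u - φ k) (G - gradient (φ k)) (fun n => φ n - φ k) where
  isC1c n := (h.isC1c n).sub (h.isC1c k)
  tendsto_local S hS hSΩ := by
    simpa using h.tendsto_local S hS hSΩ
  tendsto_grad := by
    refine h.tendsto_grad.congr fun n => ?_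
    rw [(h.isC1c n).gradient_sub (h.isC1c k), sub_sub_sub_cancel_right]

/-- Sobolev's inequality applied to the error upgrades local `L¹` convergence to `L^Q` convergence
up to the inner boundary. -/
theorem tendsto_eLpNorm_sub_of_isApprox (hL : AdmissibleWeight N p q s r T R L) {Q : ℝ}
    {S : NNReal} (hS : SobolevBound N p r T R L Q S)
    (hu : AEStronglyMeasurable u (volume.restrict (annulus N r R)))
    (hG : AEStronglyMeasurable G (volume.restrict (annulus N r R)))
    (h : IsApprox N p r R L u G φ) :
    Tendsto (fun n => eLpNorm (φ n - u) (ENNReal.ofReal Q)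
      (volume.restrict (annulus N r (T : EReal)))) atTop (𝓝 0) := by
  have hb : ∀ n, eLpNorm (φ n - u) (ENNReal.ofReal Q)
      (volume.restrict (annulus N r (T : EReal))) ≤
      S * eLpNorm (gradient (φ n) - G) (ENNReal.ofReal p) (weightedVolume N r R L) := fun n => by
    rw [eLpNorm_sub_comm, eLpNorm_sub_comm (gradient (φ n))]
    exact hL.eLpNorm_le_of_isApprox hS
      (hu.sub (h.isC1c n).contDiff.continuous.aestronglyMeasurable)
      (hG.sub (h.isC1c n).contDiff.continuous_gradient.aestronglyMeasurable) (isApprox_sub h n)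
  have hlim := ENNReal.Tendsto.const_mul (a := (S : ℝ≥0∞)) h.tendsto_grad
    (Or.inr ENNReal.coe_ne_top)
  rw [mul_zero] at hlim
  exact tendsto_of_tendsto_of_tendsto_of_le_of_le tendsto_const_nhds hlim (fun _ => zero_le) hb

/-- Convergence in `L^Q` implies convergence in measure, hence a.e. along a subsequence. Pointwise
convergence is what the dominated convergence argument in `memD0_mul_comp` uses. -/
theorem exists_isApprox_tendsto_ae (hL : AdmissibleWeight N p q s r T R L) {Q : ℝ} (hQ : 0 < Q)
    {S : NNReal} (hS : SobolevBound N p r T R L Q S)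
    (hu : AEStronglyMeasurable u (volume.restrict (annulus N r R)))
    (hG : AEStronglyMeasurable G (volume.restrict (annulus N r R)))
    (h : IsApprox N p r R L u G φ) :
    ∃ ψ, IsApprox N p r R L u G ψ ∧
      ∀ᵐ x ∂(volume.restrict (annulus N r (T : EReal))), Tendsto (fun n => ψ n x) atTop
        (𝓝 (u x)) := by
  have h1 := tendstoInMeasure_of_tendsto_eLpNorm (by simpa using hQ)
    (fun n => (h.isC1c n).contDiff.continuous.aestronglyMeasurable)
    (hu.mono_measure hL.restrict_le) (hL.tendsto_eLpNorm_sub_of_isApprox hS hu hG h)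
  obtain ⟨ns, hns, hae⟩ := h1.exists_seq_tendsto_ae
  exact ⟨fun n => φ (ns n), ⟨fun n => h.isC1c _,
    fun S hS hSΩ => (h.tendsto_local S hS hSΩ).comp hns.tendsto_atTop,
    h.tendsto_grad.comp hns.tendsto_atTop⟩, hae⟩

/-- The gradient is bounded with compact support in the annulus, where `L` is locally integrable. -/
theorem eLpNorm_gradient_lt_top (hL : AdmissibleWeight N p q s r T R L)
    {ψ : EuclideanSpace ℝ (Fin N) → ℝ} (hψ : IsC1c (annulus N r R) ψ) :
    eLpNorm (gradient ψ) (ENNReal.ofReal p) (weightedVolume N r R L) < ∞ := by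
  obtain ⟨K, hK⟩ := hψ.contDiff.lipschitzWith_of_hasCompactSupport hψ.hasCompactSupport one_ne_zero
  have hb : ∀ x, ‖gradient ψ x‖ ≤ (tsupport ψ).indicator (fun _ => (K : ℝ)) x := fun x => by
    by_cases hx : x ∈ tsupport ψ
    · rw [Set.indicator_of_mem hx, norm_gradient_eq]
      exact norm_fderiv_le_of_lipschitz ℝ hK
    · rw [Set.indicator_of_notMem hx, norm_gradient_eq, norm_le_zero_iff]
      by_contra hne
      exact hx (support_fderiv_subset ℝ hne)
  refine (eLpNorm_mono_real hb).trans_lt ((eLpNorm_indicator_const_le _ _).trans_lt ?_)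
  refine ENNReal.mul_lt_top enorm_lt_top (ENNReal.rpow_lt_top_of_nonneg (by positivity) ?_)
  have hts : MeasurableSet (tsupport ψ) := (isClosed_tsupport ψ).measurableSet
  rw [weightedVolume, withDensity_apply _ hts, Measure.restrict_restrict hts,
    Set.inter_eq_left.2 hψ.tsupport_subset]
  exact (hL.locallyIntegrableOn.integrableOn_compact_subset hψ.tsupport_subset
    hψ.hasCompactSupport.isCompact).lintegral_lt_top.ne

theorem eLpNorm_grad_lt_top (hL : AdmissibleWeight N p q s r T R L)
    (hG : AEStronglyMeasurable G (volume.restrict (annulus N r R)))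
    (h : IsApprox N p r R L u G φ) :
    eLpNorm G (ENNReal.ofReal p) (weightedVolume N r R L) < ∞ := by
  have hp1 : 1 ≤ ENNReal.ofReal p := by simpa using hL.one_lt.le
  have hGm := hG.mono_ac (weightedVolume_absolutelyContinuous N r R L)
  obtain ⟨n, hn⟩ := (h.tendsto_grad.eventually (Iio_mem_nhds one_pos)).exists
  have hc := (h.isC1c n).contDiff.continuous_gradient.aestronglyMeasurable
    (μ := weightedVolume N r R L)
  have := eLpNorm_sub_le hc (hc.sub hGm) hp1
  rw [sub_sub_cancel] at this
  exact this.trans_lt (ENNReal.add_lt_top.2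
    ⟨hL.eLpNorm_gradient_lt_top (h.isC1c n), lt_trans hn ENNReal.one_lt_top⟩)

end AdmissibleWeight

/-! ### Nonlinear functions of elements of `D_0` -/

theorem integrable_of_norm_le_mul {α F : Type*} [MeasurableSpace α] [NormedAddCommGroup F]
    {μ : Measure α} {f : α → F} {g : α → ℝ} (hg : Integrable g μ) (hf : AEStronglyMeasurable f μ)
    {C : ℝ} (h : ∀ x, ‖f x‖ ≤ C * ‖g x‖) : Integrable f μ :=
  (hg.norm.const_mul C).mono' hf (Eventually.of_forall h)

namespace IsC1c

variable {N : ℕ} {Ω : Set (EuclideanSpace ℝ (Fin N))} {φ : EuclideanSpace ℝ (Fin N) → ℝ}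
  {ζ : EuclideanSpace ℝ (Fin N) → ℝ} {F : ℝ → ℝ}

theorem mul_comp (h : IsC1c Ω φ) (hζ : ContDiff ℝ 1 ζ) (hF : ContDiff ℝ 1 F) (hF0 : F 0 = 0) :
    IsC1c Ω fun x => ζ x * F (φ x) := by
  have hsub : tsupport (fun x => ζ x * F (φ x)) ⊆ tsupport φ := by
    refine closure_mono fun x hx hφ => hx ?_
    simp [hφ, hF0]
  exact ⟨hζ.mul (hF.comp h.contDiff), h.hasCompactSupport.of_isClosed_subset
    (isClosed_tsupport _) hsub, hsub.trans h.tsupport_subset⟩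

theorem gradient_mul_comp (h : IsC1c Ω φ) (hζ : ContDiff ℝ 1 ζ) (hF : ContDiff ℝ 1 F)
    (x : EuclideanSpace ℝ (Fin N)) :
    gradient (fun x => ζ x * F (φ x)) x =
      (ζ x * deriv F (φ x)) • gradient φ x + F (φ x) • gradient ζ x := by
  have h1 := (hζ.differentiable one_ne_zero).differentiableAt (x := x) |>.hasFDerivAt
  have h2 := (hF.differentiable one_ne_zero).differentiableAt (x := φ x) |>.hasDerivAt
  have h3 : fderiv ℝ (fun x => ζ x * F (φ x)) x = _ :=
    (h1.mul (h2.comp_hasFDerivAt x (h.differentiableAt x).hasFDerivAt)).fderiv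
  simp only [gradient, h3, map_add, map_smul, smul_smul, Function.comp_apply]

end IsC1c

namespace AdmissibleWeight

variable {N : ℕ} {p q s r T : ℝ} {R : EReal} {L : EuclideanSpace ℝ (Fin N) → ℝ}
  {u : EuclideanSpace ℝ (Fin N) → ℝ} {G : EuclideanSpace ℝ (Fin N) → EuclideanSpace ℝ (Fin N)}
  {φ : ℕ → EuclideanSpace ℝ (Fin N) → ℝ}

/-- Integration by parts for `φ n` passes to the limit once the gradients converge in `L¹` on the
support of the test function. The embedding `exists_eLpNorm_one_le` yields this on `|x| < T` only;
`hzero` removes the rest. -/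
theorem hasWeakGradient_of_isApprox (hL : AdmissibleWeight N p q s r T R L)
    (hu : LocallyIntegrableOn u (annulus N r R)) (hG : LocallyIntegrableOn G (annulus N r R))
    (h : IsApprox N p r R L u G φ)
    (hzero : ∀ x, T ≤ ‖x‖ → G x = 0 ∧ ∀ n, gradient (φ n) x = 0) :
    HasWeakGradient (annulus N r R) u G := by
  refine ⟨hu, hG, fun ψ e hψ hψc hψΩ => ?_⟩
  have hψ1 : ContDiff ℝ 1 ψ := hψ.of_le (by simp)
  have hK : IsCompact (tsupport ψ) := hψc.isCompact
  have hKm : MeasurableSet (tsupport ψ) := (isClosed_tsupport ψ).measurableSet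
  obtain ⟨B, hB⟩ := hψ1.lipschitzWith_of_hasCompactSupport hψc one_ne_zero
  obtain ⟨B', hB'⟩ := hψ1.continuous.bounded_above_of_compact_support hψc
  have hdψ : ∀ x, ‖fderiv ℝ ψ x e‖ ≤ B * ‖e‖ := fun x =>
    (ContinuousLinearMap.le_opNorm _ _).trans
      (mul_le_mul_of_nonneg_right (norm_fderiv_le_of_lipschitz ℝ hB) (norm_nonneg e))
  have hdψc : Continuous fun x => fderiv ℝ ψ x e :=
    (hψ1.continuous_fderiv one_ne_zero).clm_apply continuous_const
  have hdψ0 : ∀ x ∉ tsupport ψ, fderiv ℝ ψ x e = 0 := fun x hx => by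
    have : fderiv ℝ ψ x = 0 := by
      by_contra hne
      exact hx (support_fderiv_subset ℝ hne)
    simp [this]
  have hψ0 : ∀ x ∉ tsupport ψ, ψ x = 0 := fun x hx => image_eq_zero_of_notMem_tsupport hx
  -- All integrals are moved to the compact support of `ψ`, on which every function involved is
  -- integrable.
  have hred : ∀ f : EuclideanSpace ℝ (Fin N) → ℝ, (∀ x ∉ tsupport ψ, f x = 0) →
      ∫ x in annulus N r R, f x = ∫ x in tsupport ψ, f x := fun f hf => by
    rw [setIntegral_eq_of_subset_of_forall_sdiff_eq_zero (measurableSet_annulus _ _ _) hψΩ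
      fun x hx => hf x hx.2]
  rw [hred _ fun x hx => by rw [hdψ0 x hx, mul_zero], hred _ fun x hx => by
    rw [hψ0 x hx, mul_zero]]
  have huK : Integrable u (volume.restrict (tsupport ψ)) :=
    hu.integrableOn_compact_subset hψΩ hK
  have hGK : Integrable G (volume.restrict (tsupport ψ)) :=
    hG.integrableOn_compact_subset hψΩ hK
  have hφK : ∀ n, Integrable (φ n) (volume.restrict (tsupport ψ)) := fun n =>
    ((h.isC1c n).contDiff.continuous.continuousOn).integrableOn_compact hK
  have hgφK : ∀ n, Integrable (gradient (φ n)) (volume.restrict (tsupport ψ)) := fun n =>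
    ((h.isC1c n).contDiff.continuous_gradient.continuousOn).integrableOn_compact hK
  have hI1 : ∀ f : EuclideanSpace ℝ (Fin N) → ℝ, Integrable f (volume.restrict (tsupport ψ)) →
      Integrable (fun x => f x * fderiv ℝ ψ x e) (volume.restrict (tsupport ψ)) := fun f hf =>
    integrable_of_norm_le_mul hf (hf.1.mul hdψc.aestronglyMeasurable) (C := B * ‖e‖) fun x => by
      rw [norm_mul, mul_comm]; gcongr; exact hdψ x
  have hI2 : ∀ V : EuclideanSpace ℝ (Fin N) → EuclideanSpace ℝ (Fin N),
      Integrable V (volume.restrict (tsupport ψ)) →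
      Integrable (fun x => inner ℝ (V x) e * ψ x) (volume.restrict (tsupport ψ)) := fun V hV =>
    integrable_of_norm_le_mul hV.norm ((hV.1.inner aestronglyMeasurable_const).mul
      hψ1.continuous.aestronglyMeasurable) (C := ‖e‖ * B') fun x => by
      rw [norm_mul, norm_norm, mul_right_comm, mul_comm ‖e‖]
      exact mul_le_mul (norm_inner_le_norm _ _) (hB' x) (norm_nonneg _) (by positivity)
  have hibp : ∀ n, ∫ x in tsupport ψ, φ n x * fderiv ℝ ψ x e =
      -∫ x in tsupport ψ, inner ℝ (gradient (φ n) x) e * ψ x := by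
    intro n
    have hg : ∀ x, inner ℝ (gradient (φ n) x) e = fderiv ℝ (φ n) x e := fun x => by
      simp [gradient]
    simp_rw [hg]
    have hc1 := (h.isC1c n).contDiff
    have hc2 : Continuous fun x => fderiv ℝ (φ n) x e :=
      (hc1.continuous_fderiv one_ne_zero).clm_apply continuous_const
    have hz1 : ∀ x ∉ tsupport ψ, φ n x * fderiv ℝ ψ x e = 0 := fun x hx => by
      rw [hdψ0 x hx, mul_zero]
    have hz2 : ∀ x ∉ tsupport ψ, fderiv ℝ (φ n) x e * ψ x = 0 := fun x hx => by
      rw [hψ0 x hx, mul_zero]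
    rw [setIntegral_eq_integral_of_forall_compl_eq_zero hz1,
      setIntegral_eq_integral_of_forall_compl_eq_zero hz2]
    refine integral_mul_fderiv_eq_neg_fderiv_mul_of_integrable ?_ ?_ ?_
      (fun x _ => (h.isC1c n).differentiableAt x)
      (fun x _ => (hψ1.differentiable one_ne_zero).differentiableAt)
    · exact (hc2.mul hψ1.continuous).integrable_of_hasCompactSupport hψc.mul_left
    · exact (hc1.continuous.mul hdψc).integrable_of_hasCompactSupport
        (hK.of_isClosed_subset (isClosed_tsupport _) (closure_minimal (fun x hx => by
          by_contra hne; exact hx (hz1 x hne)) (isClosed_tsupport ψ)))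
    · exact (hc1.continuous.mul hψ1.continuous).integrable_of_hasCompactSupport hψc.mul_left
  have hlim1 : Tendsto (fun n => ∫ x in tsupport ψ, φ n x * fderiv ℝ ψ x e) atTop
      (𝓝 (∫ x in tsupport ψ, u x * fderiv ℝ ψ x e)) := by
    refine tendsto_integral_of_L1 _ (hI1 u huK).1 (Eventually.of_forall fun n => hI1 _ (hφK n)) ?_
    have hlim := ENNReal.Tendsto.const_mul (a := ENNReal.ofReal (B * ‖e‖))
      (h.tendsto_local _ hK hψΩ) (Or.inr ENNReal.ofReal_ne_top)
    rw [mul_zero] at hlim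
    refine tendsto_of_tendsto_of_tendsto_of_le_of_le tendsto_const_nhds hlim (fun _ => zero_le)
      fun n => ?_
    dsimp only
    rw [← lintegral_const_mul' _ _ ENNReal.ofReal_ne_top]
    refine lintegral_mono fun x => ?_
    rw [← sub_mul, enorm_mul, mul_comm]
    gcongr
    rw [← ofReal_norm]
    exact ENNReal.ofReal_le_ofReal (hdψ x)
  have hlim2 : Tendsto (fun n => ∫ x in tsupport ψ, inner ℝ (gradient (φ n) x) e * ψ x) atTop
      (𝓝 (∫ x in tsupport ψ, inner ℝ (G x) e * ψ x)) := by
    refine tendsto_integral_of_L1 _ (hI2 G hGK).1 (Eventually.of_forall fun n => hI2 _ (hgφK n)) ?_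
    obtain ⟨C, hC⟩ := hL.exists_eLpNorm_one_le
    have hlim := ENNReal.Tendsto.const_mul (a := ENNReal.ofReal (‖e‖ * B') * C)
      h.tendsto_grad (Or.inr (ENNReal.mul_ne_top ENNReal.ofReal_ne_top ENNReal.coe_ne_top))
    rw [mul_zero] at hlim
    refine tendsto_of_tendsto_of_tendsto_of_le_of_le tendsto_const_nhds hlim (fun _ => zero_le)
      fun n => ?_
    have h1 := hC (gradient (φ n) - G)
      ((h.isC1c n).contDiff.continuous_gradient.aestronglyMeasurable.sub hG.aestronglyMeasurable)
    rw [eLpNorm_one_eq_lintegral_enorm] at h1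
    dsimp only
    rw [mul_assoc]
    refine le_trans ?_ (mul_le_mul_right h1 _)
    rw [← lintegral_const_mul' _ _ ENNReal.ofReal_ne_top,
      ← lintegral_indicator (measurableSet_annulus _ _ _), ← lintegral_indicator hKm]
    refine lintegral_mono fun x => ?_
    by_cases hx : x ∈ tsupport ψ
    · rw [Set.indicator_of_mem hx, ← sub_mul, ← inner_sub_left]
      by_cases hx2 : T ≤ ‖x‖
      · have := hzero x hx2
        simp [this.1, this.2 n]
      · rw [Set.indicator_of_mem (mem_annulus_coe.2 ⟨(hψΩ hx).1, not_le.1 hx2⟩),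
          ← ofReal_norm, ← ofReal_norm, ← ENNReal.ofReal_mul' (norm_nonneg _)]
        refine ENNReal.ofReal_le_ofReal ?_
        rw [norm_mul, mul_right_comm, mul_comm ‖e‖]
        exact mul_le_mul (norm_inner_le_norm _ _) (hB' x) (norm_nonneg _) (by positivity)
    · rw [Set.indicator_of_notMem hx]; exact zero_le
  exact tendsto_nhds_unique hlim1 ((hlim2.neg).congr fun n => (hibp n).symm)

/-- Truncated nonlinear functions of elements of `D_0^{1,p}(Ω; L)` are in `D_0^{1,p}(Ω; L)`. -/
theorem memD0_mul_comp (hL : AdmissibleWeight N p q s r T R L) {S : NNReal}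
    (hS : SobolevBound N p r T R L q S) (h : MemD0 p (annulus N r R) L u G)
    {ζ : EuclideanSpace ℝ (Fin N) → ℝ} {F : ℝ → ℝ} {B : ℝ}
    (hζ : ContDiff ℝ 1 ζ) (hζ0 : ∀ x, 0 ≤ ζ x) (hζB : ∀ x, ζ x ≤ B)
    (hζT : ∀ x, T ≤ ‖x‖ → ζ x = 0) (hζd : ∀ x, ‖fderiv ℝ ζ x‖ ≤ B)
    (hF : ContDiff ℝ 1 F) (hF0 : F 0 = 0) (hFB : ∀ t, ‖deriv F t‖ ≤ B) :
    MemD0 p (annulus N r R) L (fun x => ζ x * F (u x))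
      (fun x => (ζ x * deriv F (u x)) • G x + F (u x) • gradient ζ x) := by
  have hw := h.hasWeakGradient
  have hum := hw.aestronglyMeasurable
  have hGm := hw.aestronglyMeasurable_grad
  obtain ⟨φ₀, hφ₀⟩ := (hL.memD0_iff.1 h).2
  obtain ⟨φ, hφ, hae⟩ := hL.exists_isApprox_tendsto_ae hL.q_pos hS hum hGm hφ₀
  have hB0 : 0 ≤ B := (hζ0 0).trans (hζB 0)
  have hac := weightedVolume_absolutelyContinuous N r R L
  have hFL : ∀ a b, |F a - F b| ≤ B * |a - b| := fun a b => by
    have := Convex.norm_image_sub_le_of_norm_deriv_le (f := F) (s := Set.univ)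
      (fun x _ => (hF.differentiable one_ne_zero).differentiableAt) (fun x _ => hFB x) convex_univ
      (Set.mem_univ b) (Set.mem_univ a)
    simpa using this
  have hF1 : ∀ a, |F a| ≤ B * |a| := fun a => by simpa [hF0] using hFL a 0
  -- The nonnegative `ζ` attains its minimum where it vanishes, so its gradient is zero there as
  -- well, also on the sphere `‖x‖ = T`.
  have hζd0 : ∀ x, T ≤ ‖x‖ → gradient ζ x = 0 := fun x hx => by
    have hmin : IsLocalMin ζ x := Eventually.of_forall fun y => by rw [hζT x hx]; exact hζ0 y
    rw [gradient, hmin.fderiv_eq_zero, map_zero]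
  have hζg : ∀ x, ‖gradient ζ x‖ ≤ B := fun x => by rw [norm_gradient_eq]; exact hζd x
  have hζa : ∀ x, |ζ x| ≤ B := fun x => by rw [abs_of_nonneg (hζ0 x)]; exact hζB x
  have hdF : Continuous (deriv F) := hF.continuous_deriv le_rfl
  have hm1 : AEStronglyMeasurable (fun x => ζ x * F (u x)) (volume.restrict (annulus N r R)) :=
    hζ.continuous.aestronglyMeasurable.mul (hF.continuous.comp_aestronglyMeasurable hum)
  have hm2 : AEStronglyMeasurable
      (fun x => (ζ x * deriv F (u x)) • G x + F (u x) • gradient ζ x)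
      (volume.restrict (annulus N r R)) :=
    ((hζ.continuous.aestronglyMeasurable.mul (hdF.comp_aestronglyMeasurable hum)).smul hGm).add
      ((hF.continuous.comp_aestronglyMeasurable hum).smul
        hζ.continuous_gradient.aestronglyMeasurable)
  have happ : IsApprox N p r R L (fun x => ζ x * F (u x))
      (fun x => (ζ x * deriv F (u x)) • G x + F (u x) • gradient ζ x)
      (fun n x => ζ x * F (φ n x)) := by
    refine ⟨fun n => (hφ.isC1c n).mul_comp hζ hF hF0, fun K hK hKΩ => ?_, ?_⟩
    · have hlim := ENNReal.Tendsto.const_mul (a := ENNReal.ofReal (B * B))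
        (hφ.tendsto_local K hK hKΩ) (Or.inr ENNReal.ofReal_ne_top)
      rw [mul_zero] at hlim
      refine tendsto_of_tendsto_of_tendsto_of_le_of_le tendsto_const_nhds hlim (fun _ => zero_le)
        fun n => ?_
      dsimp only
      rw [← lintegral_const_mul' _ _ ENNReal.ofReal_ne_top]
      refine lintegral_mono fun x => ?_
      rw [← mul_sub, ← ofReal_norm, ← ofReal_norm, ← ENNReal.ofReal_mul' (norm_nonneg _)]
      refine ENNReal.ofReal_le_ofReal ?_
      rw [norm_mul, mul_assoc]
      exact mul_le_mul (hζa x) (hFL _ _) (norm_nonneg _) hB0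
    · have hp1 : 1 ≤ ENNReal.ofReal p := by simpa using hL.one_lt.le
      have hp0 : ENNReal.ofReal p ≠ 0 := by simpa using hL.p_pos
      set m := weightedVolume N r R L with hm
      have humm := hum.mono_ac hac
      have hGmm := hGm.mono_ac hac
      -- The gradient error splits in three. `T1` follows the convergence of the gradients; `T2`
      -- tends to zero by dominated convergence, with a multiple of `|G|^p` as majorant; `T3` is
      -- controlled by Hölder's inequality with `L ∈ L^{q/(q-p)}` and the `L^q` convergence of `φ
      -- n`.
      let T1 : ℕ → EuclideanSpace ℝ (Fin N) → EuclideanSpace ℝ (Fin N) := fun n x =>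
        (ζ x * deriv F (φ n x)) • (gradient (φ n) x - G x)
      let T2 : ℕ → EuclideanSpace ℝ (Fin N) → EuclideanSpace ℝ (Fin N) := fun n x =>
        (ζ x * (deriv F (φ n x) - deriv F (u x))) • G x
      let T3 : ℕ → EuclideanSpace ℝ (Fin N) → EuclideanSpace ℝ (Fin N) := fun n x =>
        (F (φ n x) - F (u x)) • gradient ζ x
      have hφc : ∀ n, AEStronglyMeasurable (φ n) m := fun n =>
        (hφ.isC1c n).contDiff.continuous.aestronglyMeasurable
      have hT1m : ∀ n, AEStronglyMeasurable (T1 n) m := fun n =>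
        (hζ.continuous.aestronglyMeasurable.mul (hdF.comp_aestronglyMeasurable (hφc n))).smul
          ((hφ.isC1c n).contDiff.continuous_gradient.aestronglyMeasurable.sub hGmm)
      have hT2m : ∀ n, AEStronglyMeasurable (T2 n) m := fun n =>
        (hζ.continuous.aestronglyMeasurable.mul ((hdF.comp_aestronglyMeasurable (hφc n)).sub
          (hdF.comp_aestronglyMeasurable humm))).smul hGmm
      have hT3m : ∀ n, AEStronglyMeasurable (T3 n) m := fun n =>
        ((hF.continuous.comp_aestronglyMeasurable (hφc n)).sub
          (hF.continuous.comp_aestronglyMeasurable humm)).smul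
          hζ.continuous_gradient.aestronglyMeasurable
      have heq : ∀ n, gradient (fun x => ζ x * F (φ n x)) -
          (fun x => (ζ x * deriv F (u x)) • G x + F (u x) • gradient ζ x) =
          T1 n + T2 n + T3 n := fun n => by
        ext1 x
        simp only [Pi.sub_apply, Pi.add_apply, (hφ.isC1c n).gradient_mul_comp hζ hF, T1, T2, T3]
        module
      have hT1 : Tendsto (fun n => eLpNorm (T1 n) (ENNReal.ofReal p) m) atTop (𝓝 0) := by
        have hlim := ENNReal.Tendsto.const_mul (a := ENNReal.ofReal (B * B))
          hφ.tendsto_grad (Or.inr ENNReal.ofReal_ne_top)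
        rw [mul_zero] at hlim
        refine tendsto_of_tendsto_of_tendsto_of_le_of_le tendsto_const_nhds hlim
          (fun _ => zero_le) fun n => ?_
        refine eLpNorm_le_mul_eLpNorm_of_ae_le_mul (Eventually.of_forall fun x => ?_) _
        simp only [T1]
        rw [norm_smul, norm_mul]
        gcongr
        · exact hζa x
        · exact hFB _
        · exact le_rfl
      have hT2 : Tendsto (fun n => eLpNorm (T2 n) (ENNReal.ofReal p) m) atTop (𝓝 0) := by
        have hGfin := hL.eLpNorm_grad_lt_top hGm hφ
        have hnorm : ∀ V : EuclideanSpace ℝ (Fin N) → EuclideanSpace ℝ (Fin N),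
            eLpNorm V (ENNReal.ofReal p) m = (∫⁻ x, ‖V x‖ₑ ^ p ∂m) ^ (1 / p) := fun V => by
          rw [eLpNorm_eq_lintegral_rpow_enorm_toReal hp0 ENNReal.ofReal_ne_top,
            ENNReal.toReal_ofReal hL.p_pos.le]
        simp_rw [hnorm]
        rw [hnorm] at hGfin
        have hGfin' : ∫⁻ x, ‖G x‖ₑ ^ p ∂m < ∞ :=
          (ENNReal.rpow_lt_top_iff_of_pos (by have := hL.p_pos; positivity)).1 hGfin
        have hae' : ∀ᵐ x ∂m, x ∈ annulus N r R ∧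
            (x ∈ annulus N r (T : EReal) → Tendsto (fun n => φ n x) atTop (𝓝 (u x))) := by
          refine hac.ae_le ?_
          rw [ae_restrict_iff' (measurableSet_annulus _ _ _)] at hae
          filter_upwards [ae_restrict_mem (measurableSet_annulus _ _ _), ae_restrict_of_ae hae]
            with x h1 h2 using ⟨h1, h2⟩
        have hdct := tendsto_lintegral_of_dominated_convergence' (μ := m)
          (F := fun n x => ‖T2 n x‖ₑ ^ p) (f := fun _ => 0)
          (fun x => ENNReal.ofReal (B * (B + B)) ^ p * ‖G x‖ₑ ^ p)
          (fun n => (hT2m n).enorm.pow_const p)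
          (fun n => Eventually.of_forall fun x => by
            dsimp only [T2]
            rw [enorm_smul, ENNReal.mul_rpow_of_nonneg _ _ hL.p_pos.le]
            gcongr
            · exact hL.p_pos.le
            rw [← ofReal_norm]
            refine ENNReal.ofReal_le_ofReal ?_
            rw [norm_mul]
            exact mul_le_mul (hζa x) ((norm_sub_le _ _).trans (add_le_add (hFB _) (hFB _)))
              (norm_nonneg _) hB0)
          (by
            rw [lintegral_const_mul' _ _ (ENNReal.rpow_ne_top_of_nonneg hL.p_pos.le
              ENNReal.ofReal_ne_top)]
            exact ENNReal.mul_ne_top (ENNReal.rpow_ne_top_of_nonneg hL.p_pos.le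
              ENNReal.ofReal_ne_top) hGfin'.ne)
          (by
            filter_upwards [hae'] with x hx
            by_cases hxT : T ≤ ‖x‖
            · simp [T2, hζT x hxT, hL.p_pos]
            · have h1 := hx.2 (mem_annulus_coe.2 ⟨hx.1.1, not_le.1 hxT⟩)
              have h2 : Tendsto (fun n => T2 n x) atTop
                  (𝓝 ((ζ x * (deriv F (u x) - deriv F (u x))) • G x)) :=
                (((hdF.tendsto _).comp h1).sub_const _ |>.const_mul _).smul_const _
              rw [sub_self, mul_zero, zero_smul] at h2
              have h3 := (ENNReal.continuous_rpow_const (y := p)).tendsto _ |>.comp h2.enorm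
              rwa [enorm_zero, ENNReal.zero_rpow_of_pos hL.p_pos] at h3)
        rw [lintegral_zero] at hdct
        have h3 := (ENNReal.continuous_rpow_const (y := 1 / p)).tendsto _ |>.comp hdct
        rwa [ENNReal.zero_rpow_of_pos (by have := hL.p_pos; positivity)] at h3
      have hT3 : Tendsto (fun n => eLpNorm (T3 n) (ENNReal.ofReal p) m) atTop (𝓝 0) := by
        have h0 := hL.tendsto_eLpNorm_sub_of_isApprox hS hum hGm hφ
        set ν := (volume : Measure (EuclideanSpace ℝ (Fin N))).restrict (annulus N r (T : EReal))
          with hν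
        have hlim := ENNReal.Tendsto.const_mul
          (a := ENNReal.ofReal (B * B) * eLpNorm L (weightExp p q) ν ^ (1 / p)) h0
          (Or.inr (ENNReal.mul_ne_top ENNReal.ofReal_ne_top
            (ENNReal.rpow_ne_top_of_nonneg (by have := hL.p_pos; positivity)
              hL.memLp.eLpNorm_ne_top)))
        rw [mul_zero] at hlim
        refine tendsto_of_tendsto_of_tendsto_of_le_of_le tendsto_const_nhds hlim
          (fun _ => zero_le) fun n => ?_
        dsimp only
        have hd : AEStronglyMeasurable (φ n - u) ν :=
          ((hφ.isC1c n).contDiff.continuous.aestronglyMeasurable).sub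
            (hum.mono_measure hL.restrict_le)
        have h1 : eLpNorm (T3 n) (ENNReal.ofReal p) m ≤ ENNReal.ofReal (B * B) *
            eLpNorm ((annulus N r (T : EReal)).indicator (φ n - u)) (ENNReal.ofReal p) m := by
          refine eLpNorm_le_mul_eLpNorm_of_ae_le_mul ?_ _
          filter_upwards [hac.ae_le (ae_restrict_mem (measurableSet_annulus _ _ _))] with x hx
          by_cases hxT : T ≤ ‖x‖
          · simp only [T3, hζd0 x hxT, smul_zero, norm_zero]; positivity
          · rw [Set.indicator_of_mem (mem_annulus_coe.2 ⟨hx.1, not_le.1 hxT⟩)]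
            simp only [T3]
            rw [norm_smul, mul_right_comm]
            exact mul_le_mul (hFL _ _) (hζg x) (norm_nonneg _) (by positivity)
        refine h1.trans ?_
        rw [mul_assoc]
        gcongr
        rw [eLpNorm_indicator_eq_eLpNorm_restrict (measurableSet_annulus _ _ _), hm,
          weightedVolume, restrict_withDensity (measurableSet_annulus _ _ _),
          Measure.restrict_restrict (measurableSet_annulus _ _ _),
          Set.inter_eq_left.2 hL.annulus_subset, ← hν,
          eLpNorm_eq_lintegral_rpow_enorm_toReal hp0 ENNReal.ofReal_ne_top,
          ENNReal.toReal_ofReal hL.p_pos.le, lintegral_withDensity_eq_lintegral_mul₀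
          (hL.aemeasurable.mono_measure hL.restrict_le).ennreal_ofReal (hd.enorm.pow_const p)]
        have h2 := lintegral_enorm_mul_rpow_le
          (hL.aemeasurable.mono_measure hL.restrict_le).aestronglyMeasurable hL.p_pos hL.le_q hd
        calc _ ≤ (eLpNorm L (weightExp p q) ν * eLpNorm (φ n - u) (ENNReal.ofReal q) ν ^ p)
              ^ (1 / p) := by
              have := hL.p_pos
              gcongr
              refine le_trans (lintegral_mono fun x => ?_) h2
              rw [Pi.mul_apply]
              gcongr
              exact Real.ofReal_le_enorm _
          _ = _ := by
              have := hL.p_pos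
              rw [ENNReal.mul_rpow_of_nonneg _ _ (by positivity), ← ENNReal.rpow_mul,
                mul_one_div_cancel this.ne', ENNReal.rpow_one]
      have hsum := (hT1.add hT2).add hT3
      simp only [add_zero] at hsum
      refine tendsto_of_tendsto_of_tendsto_of_le_of_le tendsto_const_nhds hsum
        (fun _ => zero_le) fun n => ?_
      dsimp only
      rw [heq]
      refine (eLpNorm_add_le ((hT1m n).add (hT2m n)) (hT3m n) hp1).trans ?_
      gcongr
      exact eLpNorm_add_le (hT1m n) (hT2m n) hp1
  have hloc : IsLocallyClosed (annulus N r R) := (isOpen_annulus N r R).isLocallyClosed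
  have hlocu : LocallyIntegrableOn (fun x => ζ x * F (u x)) (annulus N r R) := by
    rw [locallyIntegrableOn_iff hloc]
    intro K hKΩ hK
    refine integrable_of_norm_le_mul (hw.locallyIntegrableOn.integrableOn_compact_subset hKΩ hK)
      (hm1.mono_measure (Measure.restrict_mono_set volume hKΩ)) (C := B * B) fun x => ?_
    rw [norm_mul, mul_assoc]
    exact mul_le_mul (hζa x) (hF1 _) (norm_nonneg _) hB0
  have hlocG : LocallyIntegrableOn
      (fun x => (ζ x * deriv F (u x)) • G x + F (u x) • gradient ζ x) (annulus N r R) := by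
    rw [locallyIntegrableOn_iff hloc]
    intro K hKΩ hK
    have hmono := Measure.restrict_mono_set (volume : Measure (EuclideanSpace ℝ (Fin N))) hKΩ
    refine ((integrable_of_norm_le_mul
      (hw.locallyIntegrableOn_grad.integrableOn_compact_subset hKΩ hK).norm
      (((hζ.continuous.aestronglyMeasurable.mul (hdF.comp_aestronglyMeasurable hum)).smul
        hGm).mono_measure hmono) (C := B * B) fun x => ?_).add
      (integrable_of_norm_le_mul (hw.locallyIntegrableOn.integrableOn_compact_subset hKΩ hK)
      (((hF.continuous.comp_aestronglyMeasurable hum).smul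
        hζ.continuous_gradient.aestronglyMeasurable).mono_measure hmono) (C := B * B)
        fun x => ?_))
    · rw [Pi.smul_apply', Pi.mul_apply, norm_smul, norm_norm, norm_mul]
      gcongr
      · exact hζa x
      · exact hFB _
    · rw [norm_smul, mul_right_comm]
      exact mul_le_mul (hF1 _) (hζg x) (norm_nonneg _) (by positivity)
  refine hL.memD0_iff.2 ⟨hL.hasWeakGradient_of_isApprox hlocu hlocG happ fun x hx => ⟨?_, ?_⟩,
    _, happ⟩
  · simp [hζT x hx, hζd0 x hx]
  · intro n
    rw [(hφ.isC1c n).gradient_mul_comp hζ hF]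
    simp [hζT x hx, hζd0 x hx]

end AdmissibleWeight

/-! ### Truncated powers and Young's inequality -/

/-- The truncated power `min(|t|, M)^k`. -/
noncomputable def truncPow (k M t : ℝ) : ℝ := min |t| M ^ k

/-- The primitive of the truncated power that vanishes at `0`. -/
noncomputable def truncPowPrim (k M t : ℝ) : ℝ := ∫ x in (0 : ℝ)..t, truncPow k M x

section TruncPow

variable {k M : ℝ}

theorem continuous_truncPow (hk : 0 ≤ k) : Continuous (truncPow k M) :=
  (continuous_abs.min continuous_const).rpow_const fun _ => Or.inr hk

theorem truncPow_nonneg (hM : 0 ≤ M) (t : ℝ) : 0 ≤ truncPow k M t :=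
  Real.rpow_nonneg (le_min (abs_nonneg t) hM) k

theorem truncPow_le_of_abs_le (hk : 0 ≤ k) (hM : 0 ≤ M) {t t' : ℝ} (h : |t| ≤ |t'|) :
    truncPow k M t ≤ truncPow k M t' :=
  Real.rpow_le_rpow (le_min (abs_nonneg t) hM) (min_le_min_right M h) hk

theorem truncPow_le (hk : 0 ≤ k) (hM : 0 ≤ M) (t : ℝ) : truncPow k M t ≤ M ^ k :=
  Real.rpow_le_rpow (le_min (abs_nonneg t) hM) (min_le_right _ _) hk

theorem truncPow_le_abs_rpow (hk : 0 ≤ k) (hM : 0 ≤ M) (t : ℝ) : truncPow k M t ≤ |t| ^ k :=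
  Real.rpow_le_rpow (le_min (abs_nonneg t) hM) (min_le_left _ _) hk

/-- It links the two nonlinearities of the energy estimate: the derivative used in the test function
(exponent `p * k`) is the `p`-th power of the one used in Sobolev's inequality (exponent `k`). -/
theorem truncPow_rpow (hM : 0 ≤ M) (p t : ℝ) : truncPow k M t ^ p = truncPow (p * k) M t := by
  rw [truncPow, truncPow, ← Real.rpow_mul (le_min (abs_nonneg t) hM), mul_comm]

theorem hasDerivAt_truncPowPrim (hk : 0 ≤ k) (t : ℝ) :
    HasDerivAt (truncPowPrim k M) (truncPow k M t) t :=
  intervalIntegral.integral_hasDerivAt_right ((continuous_truncPow hk).intervalIntegrable _ _)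
    ((continuous_truncPow hk).stronglyMeasurableAtFilter _ _) (continuous_truncPow hk).continuousAt

theorem deriv_truncPowPrim (hk : 0 ≤ k) : deriv (truncPowPrim k M) = truncPow k M :=
  funext fun t => (hasDerivAt_truncPowPrim hk t).deriv

/-- This is the reason for working with the primitive: `t * truncPow k M t` has a corner at `|t| =
M` when `k, M > 0`. -/
theorem contDiff_truncPowPrim (hk : 0 ≤ k) : ContDiff ℝ 1 (truncPowPrim k M) := by
  rw [contDiff_one_iff_deriv, deriv_truncPowPrim hk]
  exact ⟨fun t => (hasDerivAt_truncPowPrim hk t).differentiableAt, continuous_truncPow hk⟩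

theorem truncPowPrim_zero : truncPowPrim k M 0 = 0 := by simp [truncPowPrim]

/-- The integrand is nondecreasing in `|t|`, so it is at most its value at the endpoint. -/
theorem abs_truncPowPrim_le (hk : 0 ≤ k) (hM : 0 ≤ M) (t : ℝ) :
    |truncPowPrim k M t| ≤ |t| * truncPow k M t := by
  have := intervalIntegral.norm_integral_le_of_norm_le_const (a := 0) (b := t)
    (f := truncPow k M) (C := truncPow k M t) fun x hx => by
      rw [Real.norm_of_nonneg (truncPow_nonneg hM x)]
      refine truncPow_le_of_abs_le hk hM ?_
      rcases Set.mem_uIoc.1 hx with h | h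
      · rw [abs_of_pos h.1, abs_of_pos (h.1.trans_le h.2)]; exact h.2
      · rw [abs_of_nonpos h.2, abs_of_neg (h.1.trans_le h.2)]; linarith [h.1]
  rw [sub_zero, mul_comm] at this
  exact this

theorem truncPowPrim_neg (t : ℝ) : truncPowPrim k M (-t) = -truncPowPrim k M t := by
  have h := intervalIntegral.integral_comp_neg (a := 0) (b := t) (truncPow k M)
  have h2 : ∀ x, truncPow k M (-x) = truncPow k M x := fun x => by simp [truncPow]
  simp only [h2, neg_zero] at h
  rw [truncPowPrim, truncPowPrim, h, intervalIntegral.integral_symm]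

/-- For `0 ≤ x ≤ t`, concavity gives `min(x, M) ≥ (x/t) min(t, M)`; raising to the power `k` and
integrating produces `1/(k+1)`. The constant does not depend on `M`. -/
theorem abs_mul_truncPow_le (hk : 0 ≤ k) (hM : 0 ≤ M) (t : ℝ) :
    |t| * truncPow k M t ≤ (k + 1) * |truncPowPrim k M t| := by
  wlog ht : 0 ≤ t generalizing t
  · have := this (-t) (by linarith)
    rw [truncPowPrim_neg, abs_neg, abs_neg] at this
    simpa [truncPow] using this
  rcases ht.eq_or_lt with rfl | ht
  · simp; positivity
  have h1 : ∀ x ∈ Set.Icc 0 t, x ^ k * (truncPow k M t / t ^ k) ≤ truncPow k M x := by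
    intro x hx
    have h2 : x / t ≤ 1 := (div_le_one ht).2 hx.2
    have h3 : 0 ≤ x / t := div_nonneg hx.1 ht.le
    have h4 : x / t * min |t| M ≤ min |x| M := by
      rw [abs_of_nonneg hx.1, abs_of_pos ht]
      refine le_min ?_ ?_
      · calc x / t * min t M ≤ x / t * t := by gcongr; exact min_le_left _ _
          _ = x := by field_simp
      · calc x / t * min t M ≤ 1 * M := by gcongr; exact min_le_right _ _
          _ = M := one_mul M
    have hm : 0 ≤ min |t| M := le_min (abs_nonneg t) hM
    calc x ^ k * (truncPow k M t / t ^ k) = (x / t * min |t| M) ^ k := by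
          rw [Real.mul_rpow h3 hm, Real.div_rpow hx.1 ht.le, truncPow]; ring
      _ ≤ _ := Real.rpow_le_rpow (mul_nonneg h3 hm) h4 hk
  have h5 := intervalIntegral.integral_mono_on (μ := volume) ht.le
    (((continuous_id.rpow_const fun _ => Or.inr hk).mul continuous_const).intervalIntegrable _ _)
    ((continuous_truncPow hk).intervalIntegrable _ _) h1
  simp only [id, Pi.mul_apply] at h5
  rw [intervalIntegral.integral_mul_const, integral_rpow (Or.inl (by linarith)),
    Real.zero_rpow (by linarith), sub_zero, Real.rpow_add_one ht.ne'] at h5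
  have htk : 0 < t ^ k := Real.rpow_pos_of_pos ht k
  have h6 : t ^ k * t / (k + 1) * (truncPow k M t / t ^ k) = t * truncPow k M t / (k + 1) := by
    field_simp
  rw [h6, div_le_iff₀ (by linarith)] at h5
  rw [abs_of_pos ht, mul_comm (k + 1)]
  refine h5.trans ?_
  gcongr
  exact le_abs_self _

/-- If `2pb ≤ a`, the left side is at most `a^p / 2`; otherwise `a < 2pb` and it is at most `(2pb)^p
/ 2`. The factor `1/2` allows absorption. -/
theorem young_half {p : ℝ} (hp : 1 < p) {a b : ℝ} (ha : 0 ≤ a) (hb : 0 ≤ b) :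
    p * (a ^ (p - 1) * b) ≤ a ^ p / 2 + (2 * p) ^ p * b ^ p := by
  have hp0 : 0 < p := by linarith
  have ha1 : a ^ (p - 1) * a = a ^ p := by
    rw [← Real.rpow_add_one' ha (by linarith), sub_add_cancel]
  have hap : 0 ≤ a ^ p := Real.rpow_nonneg ha p
  have ha0 : 0 ≤ a ^ (p - 1) := Real.rpow_nonneg ha _
  rw [← Real.mul_rpow (by linarith) hb]
  rcases le_or_gt (2 * p * b) a with h | h
  · have : p * (a ^ (p - 1) * b) ≤ a ^ p / 2 := by nlinarith
    have := Real.rpow_nonneg (mul_nonneg (by linarith : 0 ≤ 2 * p) hb) p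
    linarith
  · have hc : 0 ≤ 2 * p * b := ha.trans h.le
    have h1 : a ^ (p - 1) ≤ (2 * p * b) ^ (p - 1) := Real.rpow_le_rpow ha h.le (by linarith)
    have h2 : (2 * p * b) ^ (p - 1) * (2 * p * b) = (2 * p * b) ^ p := by
      rw [← Real.rpow_add_one' hc (by linarith), sub_add_cancel]
    have h3 := mul_le_mul_of_nonneg_right h1 hc
    nlinarith [mul_nonneg ha0 (mul_nonneg hp0.le hb)]

end TruncPow

/-! ### The energy estimate -/

namespace AdmissibleWeight

variable {N : ℕ} {p q s r T : ℝ} {R : EReal} {L K : EuclideanSpace ℝ (Fin N) → ℝ}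
  {u : EuclideanSpace ℝ (Fin N) → ℝ} {G : EuclideanSpace ℝ (Fin N) → EuclideanSpace ℝ (Fin N)}

/-- Hölder's inequality for an integral over `Ω` of a function concentrated on `r < |x| < b`. -/
theorem lintegral_le_of_le_on_annulus (hL : AdmissibleWeight N p q s r T R L)
    {W : EuclideanSpace ℝ (Fin N) → ℝ}
    (hWm : AEMeasurable W (volume.restrict (annulus N r R)))
    {b : ℝ} (hb : b ≤ T) {g : EuclideanSpace ℝ (Fin N) → ℝ}
    (hg : AEStronglyMeasurable g (volume.restrict (annulus N r R)))
    {f : EuclideanSpace ℝ (Fin N) → ℝ} {Θ : ℝ} (hΘ : 0 ≤ Θ)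
    (hf : ∀ x, ‖x‖ < b → f x ≤ |W x| * (Θ * |g x|) ^ p) (hf0 : ∀ x, b ≤ ‖x‖ → f x ≤ 0) :
    ∫⁻ x in annulus N r R, ENNReal.ofReal (f x) ≤
      eLpNorm W (weightExp p q) (volume.restrict (annulus N r (T : EReal))) *
        (ENNReal.ofReal Θ *
          eLpNorm g (ENNReal.ofReal q) (volume.restrict (annulus N r (b : EReal)))) ^ p := by
  have hp := hL.p_pos
  have hbT : annulus N r (b : EReal) ⊆ annulus N r (T : EReal) :=
    annulus_subset_annulus (by exact_mod_cast hb)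
  have hle := Measure.restrict_mono_set (volume : Measure (EuclideanSpace ℝ (Fin N))) hbT
  have h := lintegral_enorm_mul_rpow_le
    (hWm.mono_measure (hle.trans hL.restrict_le)).aestronglyMeasurable hL.p_pos hL.le_q
    (hg.mono_measure (hle.trans hL.restrict_le))
  have h1 : ∫⁻ x in annulus N r R, ENNReal.ofReal (f x) ≤
      ENNReal.ofReal Θ ^ p * ∫⁻ x in annulus N r (b : EReal), ‖W x‖ₑ * ‖g x‖ₑ ^ p := by
    rw [← lintegral_const_mul' _ _ (ENNReal.rpow_ne_top_of_nonneg hp.le ENNReal.ofReal_ne_top),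
      ← lintegral_indicator (measurableSet_annulus _ _ _),
      ← lintegral_indicator (measurableSet_annulus _ _ _)]
    refine lintegral_mono fun x => ?_
    by_cases hx : x ∈ annulus N r R
    · rw [Set.indicator_of_mem hx]
      rcases lt_or_ge ‖x‖ b with hxb | hxb
      · rw [Set.indicator_of_mem (mem_annulus_coe.2 ⟨hx.1, hxb⟩)]
        refine (ENNReal.ofReal_le_ofReal (hf x hxb)).trans (le_of_eq ?_)
        rw [ENNReal.ofReal_mul (abs_nonneg _), ← ENNReal.ofReal_rpow_of_nonneg (by positivity) hp.le,
          ENNReal.ofReal_mul hΘ, ENNReal.mul_rpow_of_nonneg _ _ hp.le, ← Real.enorm_eq_ofReal_abs,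
          ← Real.enorm_eq_ofReal_abs]
        ring
      · rw [ENNReal.ofReal_of_nonpos (hf0 x hxb)]; exact zero_le
    · rw [Set.indicator_of_notMem hx]; exact zero_le
  refine h1.trans ?_
  rw [ENNReal.mul_rpow_of_nonneg _ _ hp.le, mul_left_comm]
  gcongr
  refine h.trans ?_
  gcongr

/-- The energy estimate behind one step of Moser's iteration. -/
theorem eLpNorm_mul_truncPowPrim_le (hL : AdmissibleWeight N p q s r T R L) {S S' : NNReal} {Q : ℝ}
    (hSq : SobolevBound N p r T R L q S) (hSQ : SobolevBound N p r T R L Q S')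
    (hKm : AEMeasurable K (volume.restrict (annulus N r R)))
    (hK : MemLp K (weightExp p q) (volume.restrict (annulus N r (T : EReal)))) {lam : ℝ}
    (hu : MemD0 p (annulus N r R) L u G)
    (hsol : ∀ (h : EuclideanSpace ℝ (Fin N) → ℝ)
      (H : EuclideanSpace ℝ (Fin N) → EuclideanSpace ℝ (Fin N)),
      MemD0 p (annulus N r R) L h H →
        ∫ x in annulus N r R, L x * ‖G x‖ ^ (p - 2) * inner ℝ (G x) (H x) =
          lam * ∫ x in annulus N r R, K x * |u x| ^ (p - 2) * u x * h x)
    {k M : ℝ} (hk : 0 ≤ k) (hM : 0 ≤ M) {b Θ : ℝ} (hb : b ≤ T) (hΘ : 1 ≤ Θ)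
    {η : EuclideanSpace ℝ (Fin N) → ℝ} (hη : ContDiff ℝ 1 η) (hη0 : ∀ x, 0 ≤ η x)
    (hη1 : ∀ x, η x ≤ 1) (hηb : ∀ x, b ≤ ‖x‖ → η x = 0) (hηd : ∀ x, ‖fderiv ℝ η x‖ ≤ Θ) :
    eLpNorm (fun x => η x * truncPowPrim k M (u x)) (ENNReal.ofReal Q)
        (volume.restrict (annulus N r (T : EReal))) ≤
      S' * (2 * ((2 * ENNReal.ofReal ((2 * p) ^ p) *
          eLpNorm L (weightExp p q) (volume.restrict (annulus N r (T : EReal))) +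
        2 * ENNReal.ofReal |lam| *
          eLpNorm K (weightExp p q) (volume.restrict (annulus N r (T : EReal)))) ^ (1 / p) *
        (ENNReal.ofReal Θ * eLpNorm (fun x => u x * truncPow k M (u x)) (ENNReal.ofReal q)
          (volume.restrict (annulus N r (b : EReal)))))) := by
  have hp := hL.p_pos
  have hp1 := hL.one_lt
  have hw := hu.hasWeakGradient
  have hum := hw.aestronglyMeasurable
  have hGm := hw.aestronglyMeasurable_grad
  have hac := weightedVolume_absolutelyContinuous N r R L
  obtain ⟨φ, hφ⟩ := (hL.memD0_iff.1 hu).2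
  have hGfin := hL.eLpNorm_grad_lt_top hGm hφ
  have hpos := hL.pos.mono fun x hx => hx.le
  have hp1' : 1 ≤ ENNReal.ofReal p := by simpa using hp1.le
  set μ := (volume : Measure (EuclideanSpace ℝ (Fin N))).restrict (annulus N r R) with hμ
  set ν := (volume : Measure (EuclideanSpace ℝ (Fin N))).restrict (annulus N r (T : EReal)) with hν
  set νb := (volume : Measure (EuclideanSpace ℝ (Fin N))).restrict (annulus N r (b : EReal))
    with hνb
  set f : EuclideanSpace ℝ (Fin N) → ℝ := fun x => truncPow k M (u x) with hf
  have hfm : AEStronglyMeasurable f μ := (continuous_truncPow hk).comp_aestronglyMeasurable hum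
  have hf0 : ∀ x, 0 ≤ f x := fun x => truncPow_nonneg hM _
  have hηgm : AEStronglyMeasurable (gradient η) μ := hη.continuous_gradient.aestronglyMeasurable
  have hηm : AEStronglyMeasurable η μ := hη.continuous.aestronglyMeasurable
  have hηg0 : ∀ x, b ≤ ‖x‖ → gradient η x = 0 := fun x hx => by
    have hmin : IsLocalMin η x := Eventually.of_forall fun y => by rw [hηb x hx]; exact hη0 y
    rw [gradient, hmin.fderiv_eq_zero, map_zero]
  have hηgΘ : ∀ x, ‖gradient η x‖ ≤ Θ := fun x => by rw [norm_gradient_eq]; exact hηd x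
  -- With `f = truncPow k M (u)`, the gradient of `η · truncPowPrim k M (u)` has norm at most `A +
  -- D`.
  set A : EuclideanSpace ℝ (Fin N) → ℝ := fun x => η x * f x * ‖G x‖ with hA
  set D : EuclideanSpace ℝ (Fin N) → ℝ := fun x => ‖gradient η x‖ * (|u x| * f x) with hD
  have hA0 : ∀ x, 0 ≤ A x := fun x => mul_nonneg (mul_nonneg (hη0 x) (hf0 x)) (norm_nonneg _)
  have hD0 : ∀ x, 0 ≤ D x := fun x => mul_nonneg (norm_nonneg _) (mul_nonneg (abs_nonneg _) (hf0 x))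
  have hAm : AEStronglyMeasurable A μ := (hηm.mul hfm).mul hGm.norm
  have hDm : AEStronglyMeasurable D μ := hηgm.norm.mul (hum.norm.mul hfm)
  set n := eLpNorm (fun x => u x * f x) (ENNReal.ofReal q) νb with hn
  have hufm : AEStronglyMeasurable (fun x => u x * f x) μ := hum.mul hfm
  have hbT : annulus N r (b : EReal) ⊆ annulus N r (T : EReal) :=
    annulus_subset_annulus (by exact_mod_cast hb)
  -- The truncation is essential here: higher powers of `u` are not yet known to be integrable,
  -- whereas `|u| f ≤ M^k |u|`.
  have hnfin : n < ∞ := by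
    have h1 : n ≤ ENNReal.ofReal (M ^ k) * eLpNorm u (ENNReal.ofReal q) νb := by
      refine eLpNorm_le_mul_eLpNorm_of_ae_le_mul (Eventually.of_forall fun x => ?_) _
      rw [norm_mul, mul_comm, Real.norm_of_nonneg (hf0 x)]
      gcongr
      exact truncPow_le hk hM _
    refine h1.trans_lt (ENNReal.mul_lt_top ENNReal.ofReal_lt_top ?_)
    refine (eLpNorm_mono_measure _ (Measure.restrict_mono_set volume hbT)).trans_lt ?_
    exact (hL.eLpNorm_le_of_isApprox hSq hum hGm hφ).trans_lt
      (ENNReal.mul_lt_top ENNReal.coe_lt_top hGfin)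
  have hAint : Integrable (fun x => L x * ‖A x‖ ^ p) μ := by
    refine ⟨hL.aemeasurable.aestronglyMeasurable.mul
      (hAm.norm.aemeasurable.pow_const p).aestronglyMeasurable, ?_⟩
    rw [hasFiniteIntegral_iff_ofReal (hpos.mono fun x hx =>
      mul_nonneg hx (Real.rpow_nonneg (norm_nonneg _) _)),
      lintegral_ofReal_mul_norm_rpow_eq hL.aemeasurable hpos hp hAm]
    refine ENNReal.rpow_lt_top_of_nonneg hp.le (ne_of_lt ?_)
    refine lt_of_le_of_lt (b := ENNReal.ofReal (M ^ k) *
      eLpNorm G (ENNReal.ofReal p) (weightedVolume N r R L))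
      (eLpNorm_le_mul_eLpNorm_of_ae_le_mul (Eventually.of_forall fun x => ?_) _)
      (ENNReal.mul_lt_top ENNReal.ofReal_lt_top hGfin)
    rw [Real.norm_of_nonneg (hA0 x)]
    simp only [hA]
    gcongr
    calc η x * f x ≤ 1 * M ^ k :=
          mul_le_mul (hη1 x) (truncPow_le hk hM _) (hf0 x) zero_le_one
      _ = M ^ k := one_mul _
  have hEY : ∫⁻ x, ENNReal.ofReal (L x * ‖D x‖ ^ p) ∂μ ≤
      eLpNorm L (weightExp p q) ν * (ENNReal.ofReal Θ * n) ^ p := by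
    refine hL.lintegral_le_of_le_on_annulus hL.aemeasurable hb hufm (by linarith)
      (fun x _ => ?_) fun x hx => ?_
    · rw [Real.norm_of_nonneg (hD0 x)]
      have h1 : D x ≤ Θ * |u x * f x| := by
        simp only [hD]
        rw [abs_mul, abs_of_nonneg (hf0 x)]
        exact mul_le_mul_of_nonneg_right (hηgΘ x) (mul_nonneg (abs_nonneg _) (hf0 x))
      exact mul_le_mul (le_abs_self _) (Real.rpow_le_rpow (hD0 x) h1 hp.le)
        (Real.rpow_nonneg (hD0 x) _) (abs_nonneg _)
    · simp [hD, hηg0 x hx, hp.ne']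
  have hLfin : eLpNorm L (weightExp p q) ν ≠ ∞ := hL.memLp.eLpNorm_ne_top
  have hKfin : eLpNorm K (weightExp p q) ν ≠ ∞ := hK.eLpNorm_ne_top
  have hΘn : (ENNReal.ofReal Θ * n) ^ p ≠ ∞ :=
    ENNReal.rpow_ne_top_of_nonneg hp.le (ENNReal.mul_ne_top ENNReal.ofReal_ne_top hnfin.ne)
  have hDint : Integrable (fun x => L x * ‖D x‖ ^ p) μ := by
    refine ⟨hL.aemeasurable.aestronglyMeasurable.mul
      (hDm.norm.aemeasurable.pow_const p).aestronglyMeasurable, ?_⟩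
    rw [hasFiniteIntegral_iff_ofReal (hpos.mono fun x hx =>
      mul_nonneg hx (Real.rpow_nonneg (norm_nonneg _) _))]
    exact hEY.trans_lt (ENNReal.mul_lt_top hLfin.lt_top hΘn.lt_top)
  -- the test function
  set ζ : EuclideanSpace ℝ (Fin N) → ℝ := fun x => η x ^ p with hζ
  have hζc : ContDiff ℝ 1 ζ :=
    (Real.contDiff_rpow_const_of_le (n := 1) (by simpa using hp1.le)).comp hη
  have hζgr : ∀ x, gradient ζ x = (p * η x ^ (p - 1)) • gradient η x := fun x => by
    have h1 := (hη.differentiable one_ne_zero).differentiableAt (x := x) |>.hasFDerivAt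
    have h2 : fderiv ℝ ζ x = _ := (h1.rpow_const (p := p) (Or.inr hp1.le)).fderiv
    rw [gradient, h2, map_smul]; rfl
  have hk' : 0 ≤ p * k := by positivity
  -- The derivative of this `F` at `u` is `f^p`, so in the tested equation the leading term becomes
  -- exactly `L A^p`.
  set F := truncPowPrim (p * k) M with hF
  have hFd : ∀ t, deriv F t = truncPow k M t ^ p := fun t => by
    rw [hF, deriv_truncPowPrim hk', truncPow_rpow hM]
  have hFa : ∀ x, |F (u x)| ≤ |u x| * f x ^ p := fun x => by
    have := abs_truncPowPrim_le hk' hM (u x)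
    rwa [← truncPow_rpow hM] at this
  have hMk : 0 ≤ M ^ (p * k) := Real.rpow_nonneg hM _
  have hpΘ : 0 ≤ p * Θ := by positivity
  have htest := hL.memD0_mul_comp hSq hu (B := 1 + p * Θ + M ^ (p * k)) hζc
    (fun x => Real.rpow_nonneg (hη0 x) p)
    (fun x => (Real.rpow_le_one (hη0 x) (hη1 x) hp.le).trans (by linarith))
    (fun x hx => by simp [hζ, hηb x (hb.trans hx), hp.ne'])
    (fun x => by
      rw [← norm_gradient_eq, hζgr, norm_smul, Real.norm_of_nonneg
        (mul_nonneg hp.le (Real.rpow_nonneg (hη0 x) _)), mul_assoc]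
      have h1 : η x ^ (p - 1) * ‖gradient η x‖ ≤ 1 * Θ :=
        mul_le_mul (Real.rpow_le_one (hη0 x) (hη1 x) (by linarith)) (hηgΘ x) (norm_nonneg _)
          zero_le_one
      nlinarith)
    (contDiff_truncPowPrim hk') truncPowPrim_zero
    (fun t => by
      rw [deriv_truncPowPrim hk', Real.norm_of_nonneg (truncPow_nonneg hM t)]
      exact (truncPow_le hk' hM t).trans (by linarith))
  have hid := hsol _ _ htest
  set Z : EuclideanSpace ℝ (Fin N) → ℝ := fun x => L x * ‖G x‖ ^ (p - 2) *
    inner ℝ (G x) ((ζ x * deriv F (u x)) • G x + F (u x) • gradient ζ x) with hZ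
  -- Beyond `L A^p`, only the term with `∇ζ` is left in `Z`. Cauchy–Schwarz and `|F(u)| ≤ |u| f^p`
  -- bound it by `p L A^{p-1} D`, and Young's inequality applies.
  have hZA : ∀ᵐ x ∂μ, |Z x - L x * ‖A x‖ ^ p| ≤
      L x * ‖A x‖ ^ p / 2 + (2 * p) ^ p * (L x * ‖D x‖ ^ p) := by
    filter_upwards [hpos] with x hx
    rw [Real.norm_of_nonneg (hA0 x), Real.norm_of_nonneg (hD0 x)]
    -- The exponent `p - 2` may be negative; at `G x = 0` both sides vanish whatever the power is
    -- there.
    have e1 : ‖G x‖ ^ (p - 2) * (‖G x‖ * ‖G x‖) = ‖G x‖ ^ p := by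
      rcases (norm_nonneg (G x)).eq_or_lt with h0 | h0
      · rw [← h0, Real.zero_rpow hp.ne']; simp
      · rw [← sq, ← Real.rpow_natCast, ← Real.rpow_add h0]; norm_num
    have e2 : ‖G x‖ ^ (p - 2) * ‖G x‖ = ‖G x‖ ^ (p - 1) := by
      rcases (norm_nonneg (G x)).eq_or_lt with h0 | h0
      · rw [← h0, Real.zero_rpow (by linarith : p - 1 ≠ 0)]; simp
      · rw [← Real.rpow_add_one h0.ne']; ring_nf
    have e3 : A x ^ p = η x ^ p * f x ^ p * ‖G x‖ ^ p := by
      rw [hA, Real.mul_rpow (mul_nonneg (hη0 x) (hf0 x)) (norm_nonneg _),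
        Real.mul_rpow (hη0 x) (hf0 x)]
    have e4 : Z x - L x * A x ^ p =
        L x * (F (u x) * (p * η x ^ (p - 1)) *
          (‖G x‖ ^ (p - 2) * inner ℝ (G x) (gradient η x))) := by
      simp only [hZ, hFd, hζgr]
      rw [e3, ← e1, inner_add_right, inner_smul_right, inner_smul_right, inner_smul_right,
        real_inner_self_eq_norm_mul_norm]
      simp only [hζ, hf]
      ring
    have e5 : f x ^ (p - 1) * f x = f x ^ p := by
      rw [← Real.rpow_add_one' (hf0 x) (by linarith), sub_add_cancel]
    have hηp : 0 ≤ η x ^ (p - 1) := Real.rpow_nonneg (hη0 x) _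
    have hGp : 0 ≤ ‖G x‖ ^ (p - 2) := Real.rpow_nonneg (norm_nonneg _) _
    rw [e4, abs_mul, abs_of_nonneg hx]
    have h1 : |F (u x) * (p * η x ^ (p - 1)) *
        (‖G x‖ ^ (p - 2) * inner ℝ (G x) (gradient η x))| ≤
        p * (A x ^ (p - 1) * D x) := by
      have h2 : |inner ℝ (G x) (gradient η x)| ≤ ‖G x‖ * ‖gradient η x‖ :=
        abs_real_inner_le_norm _ _
      rw [abs_mul, abs_mul (F (u x)), abs_of_nonneg (mul_nonneg hp.le hηp),
        abs_mul (‖G x‖ ^ (p - 2)), abs_of_nonneg hGp]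
      calc _ ≤ (|u x| * f x ^ p) * (p * η x ^ (p - 1)) *
            (‖G x‖ ^ (p - 2) * (‖G x‖ * ‖gradient η x‖)) := by
            gcongr
            · exact mul_nonneg (mul_nonneg (abs_nonneg _) (Real.rpow_nonneg (hf0 x) p))
                (mul_nonneg hp.le hηp)
            · exact hFa x
        _ = _ := by
            rw [← mul_assoc (‖G x‖ ^ (p - 2)), e2, hA, hD,
              Real.mul_rpow (mul_nonneg (hη0 x) (hf0 x)) (norm_nonneg _),
              Real.mul_rpow (hη0 x) (hf0 x), ← e5]
            ring
    calc L x * _ ≤ L x * (A x ^ p / 2 + (2 * p) ^ p * D x ^ p) := by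
          gcongr
          exact h1.trans (young_half hp1 (hA0 x) (hD0 x))
      _ = _ := by ring
  have hZint : Integrable Z μ := by
    have hZm : AEStronglyMeasurable Z μ :=
      (hL.aemeasurable.aestronglyMeasurable.mul
        (hGm.norm.aemeasurable.pow_const (p - 2)).aestronglyMeasurable).mul
        (hGm.inner htest.hasWeakGradient.aestronglyMeasurable_grad)
    have h1 : Integrable (fun x => Z x - L x * ‖A x‖ ^ p) μ :=
      ((hAint.div_const 2).add (hDint.const_mul ((2 * p) ^ p))).mono' (hZm.sub hAint.1) hZA
    exact (h1.add hAint).congr (ae_of_all _ fun x => sub_add_cancel _ _)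
  -- The integrand is at most `|K| (|u| f)^p`, since `0 ≤ η ≤ 1`; no gradient of the cutoff enters,
  -- hence the factor `1` instead of `Θ`.
  have hJ : ‖∫ x, K x * |u x| ^ (p - 2) * u x * (ζ x * F (u x)) ∂μ‖ ≤
      (eLpNorm K (weightExp p q) ν * (ENNReal.ofReal 1 * n) ^ p).toReal := by
    refine (norm_integral_le_lintegral_norm _).trans (ENNReal.toReal_mono
      (ENNReal.mul_ne_top hKfin (ENNReal.rpow_ne_top_of_nonneg hp.le
        (ENNReal.mul_ne_top ENNReal.ofReal_ne_top hnfin.ne))) ?_)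
    refine hL.lintegral_le_of_le_on_annulus hKm hb hufm zero_le_one (fun x _ => ?_) fun x hx => ?_
    · rw [one_mul, abs_mul, abs_of_nonneg (hf0 x), Real.mul_rpow (abs_nonneg _) (hf0 x),
        norm_mul, norm_mul, norm_mul, norm_mul, Real.norm_eq_abs, Real.norm_eq_abs (u x),
        Real.norm_of_nonneg (Real.rpow_nonneg (abs_nonneg (u x)) _),
        Real.norm_of_nonneg (Real.rpow_nonneg (hη0 x) p), Real.norm_eq_abs (F (u x))]
      have e1 : |u x| ^ (p - 2) * (|u x| * |u x|) = |u x| ^ p := by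
        rcases (abs_nonneg (u x)).eq_or_lt with h0 | h0
        · rw [← h0, Real.zero_rpow hp.ne']; simp
        · rw [← sq, ← Real.rpow_natCast, ← Real.rpow_add h0]; norm_num
      have h1 : η x ^ p * |F (u x)| ≤ 1 * (|u x| * f x ^ p) :=
        mul_le_mul (Real.rpow_le_one (hη0 x) (hη1 x) hp.le) (hFa x) (abs_nonneg _) zero_le_one
      calc _ ≤ |K x| * |u x| ^ (p - 2) * |u x| * (1 * (|u x| * f x ^ p)) := by gcongr
        _ = |K x| * (|u x| ^ (p - 2) * (|u x| * |u x|) * f x ^ p) := by ring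
        _ = _ := by rw [e1]
    · simp [hζ, hηb x hx, hp.ne']
  -- Half of the integral of `L A^p` is absorbed on the left, which accounts for the factors `2`; `Θ
  -- ≥ 1` puts the `K` term under the common power of `Θ`.
  have hEX : ∫⁻ x, ENNReal.ofReal (L x * ‖A x‖ ^ p) ∂μ ≤
      (2 * ENNReal.ofReal ((2 * p) ^ p) * eLpNorm L (weightExp p q) ν +
        2 * ENNReal.ofReal |lam| * eLpNorm K (weightExp p q) ν) * (ENNReal.ofReal Θ * n) ^ p := by
    have h2p : 0 ≤ (2 * p) ^ p := Real.rpow_nonneg (by linarith) _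
    have h1 : ∫ x, L x * ‖A x‖ ^ p ∂μ ≤
        2 * ((2 * p) ^ p * ∫ x, L x * ‖D x‖ ^ p ∂μ) + 2 * ∫ x, Z x ∂μ := by
      rw [← integral_const_mul, ← integral_const_mul, ← integral_const_mul, ← integral_add
        ((hDint.const_mul _).const_mul _) (hZint.const_mul _)]
      refine integral_mono_ae hAint (((hDint.const_mul _).const_mul _).add (hZint.const_mul _)) ?_
      filter_upwards [hZA] with x hx
      have := (abs_le.1 hx).1
      linarith
    have h2 : ∫ x, Z x ∂μ ≤
        |lam| * (eLpNorm K (weightExp p q) ν * (ENNReal.ofReal 1 * n) ^ p).toReal := by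
      rw [hid]
      refine (le_abs_self _).trans ?_
      rw [abs_mul]
      gcongr
      exact hJ
    have h3 : ENNReal.ofReal (∫ x, L x * ‖D x‖ ^ p ∂μ) ≤
        eLpNorm L (weightExp p q) ν * (ENNReal.ofReal Θ * n) ^ p := by
      rw [ofReal_integral_eq_lintegral_ofReal hDint (hpos.mono fun x hx =>
        mul_nonneg hx (Real.rpow_nonneg (norm_nonneg _) _))]
      exact hEY
    have h4 : ENNReal.ofReal ((eLpNorm K (weightExp p q) ν *
        (ENNReal.ofReal 1 * n) ^ p).toReal) ≤
        eLpNorm K (weightExp p q) ν * (ENNReal.ofReal Θ * n) ^ p := by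
      refine ENNReal.ofReal_toReal_le.trans ?_
      gcongr
    rw [← ofReal_integral_eq_lintegral_ofReal hAint (hpos.mono fun x hx =>
        mul_nonneg hx (Real.rpow_nonneg (norm_nonneg _) _))]
    calc ENNReal.ofReal (∫ x, L x * ‖A x‖ ^ p ∂μ)
        ≤ ENNReal.ofReal (2 * ((2 * p) ^ p * ∫ x, L x * ‖D x‖ ^ p ∂μ) + 2 *
          (|lam| * (eLpNorm K (weightExp p q) ν * (ENNReal.ofReal 1 * n) ^ p).toReal)) :=
          ENNReal.ofReal_le_ofReal (by linarith)
      _ ≤ 2 * (ENNReal.ofReal ((2 * p) ^ p) * ENNReal.ofReal (∫ x, L x * ‖D x‖ ^ p ∂μ)) +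
          2 * (ENNReal.ofReal |lam| * ENNReal.ofReal ((eLpNorm K (weightExp p q) ν *
            (ENNReal.ofReal 1 * n) ^ p).toReal)) := by
          refine ENNReal.ofReal_add_le.trans ?_
          rw [ENNReal.ofReal_mul zero_le_two, ENNReal.ofReal_mul h2p,
            ENNReal.ofReal_mul zero_le_two, ENNReal.ofReal_mul (abs_nonneg _)]
          simp
      _ ≤ 2 * (ENNReal.ofReal ((2 * p) ^ p) * (eLpNorm L (weightExp p q) ν *
            (ENNReal.ofReal Θ * n) ^ p)) + 2 * (ENNReal.ofReal |lam| *
            (eLpNorm K (weightExp p q) ν * (ENNReal.ofReal Θ * n) ^ p)) := by gcongr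
      _ = _ := by ring
  -- Sobolev's inequality for the truncated power of `u`
  have hMk' : 0 ≤ M ^ k := Real.rpow_nonneg hM _
  have hcomp := hL.memD0_mul_comp hSq hu (B := 1 + Θ + M ^ k) hη hη0
    (fun x => (hη1 x).trans (by linarith)) (fun x hx => hηb x (hb.trans hx))
    (fun x => (hηd x).trans (by linarith)) (contDiff_truncPowPrim hk) truncPowPrim_zero
    (fun t => by
      rw [deriv_truncPowPrim hk, Real.norm_of_nonneg (truncPow_nonneg hM t)]
      exact (truncPow_le hk hM t).trans (by linarith))
  obtain ⟨ψ, hψ⟩ := (hL.memD0_iff.1 hcomp).2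
  have hcw := hcomp.hasWeakGradient
  refine (hL.eLpNorm_le_of_isApprox hSQ hcw.aestronglyMeasurable hcw.aestronglyMeasurable_grad
    hψ).trans ?_
  gcongr
  have hroot : ∀ V : EuclideanSpace ℝ (Fin N) → ℝ, AEStronglyMeasurable V μ →
      eLpNorm V (ENNReal.ofReal p) (weightedVolume N r R L) =
        (∫⁻ x, ENNReal.ofReal (L x * ‖V x‖ ^ p) ∂μ) ^ (1 / p) := fun V hV => by
    rw [lintegral_ofReal_mul_norm_rpow_eq hL.aemeasurable hpos hp hV, ← ENNReal.rpow_mul,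
      mul_one_div_cancel hp.ne', ENNReal.rpow_one]; rfl
  set c := 2 * ENNReal.ofReal ((2 * p) ^ p) * eLpNorm L (weightExp p q) ν +
        2 * ENNReal.ofReal |lam| * eLpNorm K (weightExp p q) ν with hc
  -- The constant dominates the norm of `L` alone, so `D` obeys the same bound as `A`; their sum
  -- gives the outer factor `2`.
  have hLc : eLpNorm L (weightExp p q) ν ≤ c := by
    have h1 : (1 : ℝ≥0∞) ≤ ENNReal.ofReal ((2 * p) ^ p) := by
      rw [ENNReal.one_le_ofReal]
      exact Real.one_le_rpow (by linarith) hp.le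
    refine le_trans ?_ (le_self_add)
    calc eLpNorm L (weightExp p q) ν = 1 * 1 * eLpNorm L (weightExp p q) ν := by simp
      _ ≤ _ := by gcongr; exact one_le_two
  have hsplit : ∀ e : ℝ≥0∞, (e * (ENNReal.ofReal Θ * n) ^ p) ^ (1 / p) =
      e ^ (1 / p) * (ENNReal.ofReal Θ * n) := fun e => by
    rw [ENNReal.mul_rpow_of_nonneg _ _ (by positivity), ← ENNReal.rpow_mul,
      mul_one_div_cancel hp.ne', ENNReal.rpow_one]
  have hfin1 : eLpNorm A (ENNReal.ofReal p) (weightedVolume N r R L) ≤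
      c ^ (1 / p) * (ENNReal.ofReal Θ * n) := by
    rw [hroot A hAm, ← hsplit]
    gcongr
  have hfin2 : eLpNorm D (ENNReal.ofReal p) (weightedVolume N r R L) ≤
      c ^ (1 / p) * (ENNReal.ofReal Θ * n) := by
    rw [hroot D hDm, ← hsplit]
    gcongr
    exact hEY.trans (by gcongr)
  calc _ ≤ eLpNorm (A + D) (ENNReal.ofReal p) (weightedVolume N r R L) := by
        refine eLpNorm_mono_real fun x => ?_
        refine (norm_add_le _ _).trans (add_le_add ?_ ?_)
        · rw [norm_smul, deriv_truncPowPrim hk,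
            Real.norm_of_nonneg (mul_nonneg (hη0 x) (truncPow_nonneg hM _))]
        · rw [norm_smul, mul_comm]
          exact mul_le_mul_of_nonneg_left (abs_truncPowPrim_le hk hM _) (norm_nonneg _)
    _ ≤ eLpNorm A (ENNReal.ofReal p) (weightedVolume N r R L) +
        eLpNorm D (ENNReal.ofReal p) (weightedVolume N r R L) :=
        eLpNorm_add_le (hAm.mono_ac hac) (hDm.mono_ac hac) hp1'
    _ ≤ _ := by rw [two_mul]; exact add_le_add hfin1 hfin2

end AdmissibleWeight

/-! ### Moser's iteration -/

/-- By Chebyshev's inequality, for `t > C` the set where `|u| ≥ t` has measure at most `(C/t)^{e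
n}`, which tends to `0`. -/
theorem eLpNorm_top_le_of_forall_eLpNorm_le {α F : Type*} [MeasurableSpace α]
    [NormedAddCommGroup F] {μ : Measure α} {u : α → F} (hu : AEStronglyMeasurable u μ)
    {e : ℕ → ℝ} (he0 : ∀ n, 0 < e n) (he : Tendsto e atTop atTop) {C : ℝ≥0∞}
    (h : ∀ n, eLpNorm u (ENNReal.ofReal (e n)) μ ≤ C) : eLpNorm u ∞ μ ≤ C := by
  rw [eLpNorm_exponent_top]
  refine le_of_forall_gt_imp_ge_of_dense fun t ht => ?_
  rcases eq_or_ne t ∞ with rfl | htop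
  · exact le_top
  have ht0 : t ≠ 0 := (lt_of_le_of_lt zero_le ht).ne'
  have hzero : μ {x | t ≤ ‖u x‖ₑ} = 0 := by
    have h1 : ∀ n, μ {x | t ≤ ‖u x‖ₑ} ≤ (C / t) ^ e n := fun n => by
      have h2 := mul_meas_ge_le_pow_eLpNorm' μ (p := ENNReal.ofReal (e n)) (by simpa using he0 n)
        ENNReal.ofReal_ne_top hu t
      rw [ENNReal.toReal_ofReal (he0 n).le] at h2
      rw [ENNReal.div_rpow_of_nonneg _ _ (he0 n).le, ENNReal.le_div_iff_mul_le
        (Or.inl (ENNReal.rpow_pos (pos_iff_ne_zero.2 ht0) htop).ne')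
        (Or.inl (ENNReal.rpow_ne_top_of_nonneg (he0 n).le htop)), mul_comm]
      refine h2.trans ?_
      gcongr
      · exact (he0 n).le
      · exact h n
    have h3 : C / t < 1 := by
      rwa [ENNReal.div_lt_iff (Or.inl ht0) (Or.inl htop), one_mul]
    have h4 := (ENNReal.tendsto_rpow_atTop_of_base_lt_one h3).comp he
    exact le_antisymm (ge_of_tendsto' h4 h1) zero_le
  refine essSup_le_of_ae_le t ?_
  rw [← compl_compl {x | t ≤ ‖u x‖ₑ}] at hzero
  have h5 : ∀ᵐ x ∂μ, x ∈ {x | t ≤ ‖u x‖ₑ}ᶜ := hzero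
  filter_upwards [h5] with x hx
  exact (not_le.1 (show ¬ t ≤ ‖u x‖ₑ from hx)).le

/-- The constants accumulated along Moser's iteration stay bounded. -/
theorem exists_bound_of_iteration {A B χ : ℝ} (hA : 1 ≤ A) (hB : 1 ≤ B) (hχ : 1 < χ) :
    ∃ C : ℝ, 0 < C ∧ ∀ n : ℕ → ℝ≥0∞,
      (∀ k, n (k + 1) ≤ ENNReal.ofReal ((A * B ^ k) ^ (1 / χ ^ k)) * n k) →
      ∀ k, n k ≤ ENNReal.ofReal C * n 0 := by
  set θ := 1 / χ with hθ
  have hθ0 : 0 ≤ θ := by positivity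
  have hθ1 : θ < 1 := by rw [hθ, div_lt_one (by linarith)]; exact hχ
  -- The logarithms of the factors: a linear function of `k` times `χ^{-k}`, hence summable.
  set a : ℕ → ℝ := fun k => θ ^ k * (Real.log A + k * Real.log B) with ha
  have ha0 : ∀ k, 0 ≤ a k := fun k => by
    have := Real.log_nonneg hA
    have := Real.log_nonneg hB
    positivity
  have hsum : Summable a := by
    have h1 := (summable_geometric_of_lt_one hθ0 hθ1).mul_right (Real.log A)
    have h2 := (summable_pow_mul_geometric_of_norm_lt_one 1
      (by rwa [Real.norm_of_nonneg hθ0] : ‖θ‖ < 1)).mul_right (Real.log B)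
    refine (h1.add h2).congr fun k => ?_
    simp only [ha, pow_one]; ring
  have hexp : ∀ k : ℕ, (A * B ^ k) ^ (1 / χ ^ k) = Real.exp (a k) := fun k => by
    have hAB : 0 < A * B ^ k := by positivity
    rw [Real.rpow_def_of_pos hAB, Real.log_mul (by positivity) (by positivity), Real.log_pow]
    simp only [ha, hθ, div_pow, one_pow]
    ring_nf
  refine ⟨Real.exp (∑' k, a k), Real.exp_pos _, fun n hn k => ?_⟩
  have key : ∀ k, n k ≤ ENNReal.ofReal (Real.exp (∑ j ∈ Finset.range k, a j)) * n 0 := by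
    intro k
    induction k with
    | zero => simp
    | succ k ih =>
      refine (hn k).trans ?_
      rw [hexp, Finset.sum_range_succ, Real.exp_add, mul_comm (Real.exp _),
        ENNReal.ofReal_mul (Real.exp_pos _).le, mul_assoc]
      gcongr
  refine (key k).trans ?_
  gcongr
  exact hsum.sum_le_tsum _ fun j _ => ha0 j

/-- Hölder's inequality on an annulus of finite volume. Both exponents are needed: `q` to pair with
the weights, `Q` for the gain. -/
theorem SobolevBound.exists_of_le {N : ℕ} {p r T : ℝ} {R : EReal}
    {L : EuclideanSpace ℝ (Fin N) → ℝ} {q Q : ℝ} {S' : NNReal}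
    (h : SobolevBound N p r T R L Q S') (hq : 0 < q) (hqQ : q ≤ Q) :
    ∃ S : NNReal, SobolevBound N p r T R L q S := by
  have hexp : 0 ≤ 1 / (ENNReal.ofReal q).toReal - 1 / (ENNReal.ofReal Q).toReal := by
    rw [ENNReal.toReal_ofReal hq.le, ENNReal.toReal_ofReal (by linarith), sub_nonneg]
    exact one_div_le_one_div_of_le hq hqQ
  have hfin := ENNReal.rpow_ne_top_of_nonneg hexp (volume_annulus_lt_top N r T).ne
  refine ⟨S' * (volume (annulus N r (T : EReal)) ^
    (1 / (ENNReal.ofReal q).toReal - 1 / (ENNReal.ofReal Q).toReal)).toNNReal, fun φ hφ => ?_⟩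
  rw [ENNReal.coe_mul, ENNReal.coe_toNNReal hfin, mul_right_comm]
  have h1 := eLpNorm_le_eLpNorm_mul_rpow_measure_univ (ENNReal.ofReal_le_ofReal hqQ)
    (hφ.contDiff.continuous.aestronglyMeasurable
      (μ := volume.restrict (annulus N r (T : EReal))))
  rw [Measure.restrict_apply_univ] at h1
  refine h1.trans ?_
  gcongr
  exact h φ hφ

namespace AdmissibleWeight

variable {N : ℕ} {p q s r T : ℝ} {R : EReal} {L K : EuclideanSpace ℝ (Fin N) → ℝ}

/-- One step of Moser's iteration. -/
theorem exists_moser_step (hL : AdmissibleWeight N p q s r T R L) {S S' : NNReal} {Q : ℝ}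
    (hSq : SobolevBound N p r T R L q S) (hSQ : SobolevBound N p r T R L Q S') (hQ : 0 < Q)
    (hKm : AEMeasurable K (volume.restrict (annulus N r R)))
    (hK : MemLp K (weightExp p q) (volume.restrict (annulus N r (T : EReal)))) (lam : ℝ) :
    ∃ A D : ℝ, 1 ≤ A ∧ 0 < D ∧ ∀ u, IsWeakSolution p (annulus N r R) L K lam u →
      ∀ γ a b : ℝ, 1 ≤ γ → r < a → a < b → b ≤ T →
        eLpNorm u (ENNReal.ofReal (Q * γ)) (volume.restrict (annulus N r (a : EReal))) ≤
          ENNReal.ofReal ((A * γ * (1 + D / (b - a))) ^ (1 / γ)) *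
            eLpNorm u (ENNReal.ofReal (q * γ)) (volume.restrict (annulus N r (b : EReal))) := by
  obtain ⟨D, hD, hcut⟩ := exists_radial_cutoff (EuclideanSpace ℝ (Fin N))
  set c : ℝ≥0∞ := S' * (2 * (2 * ENNReal.ofReal ((2 * p) ^ p) *
      eLpNorm L (weightExp p q) (volume.restrict (annulus N r (T : EReal))) +
    2 * ENNReal.ofReal |lam| *
      eLpNorm K (weightExp p q) (volume.restrict (annulus N r (T : EReal)))) ^ (1 / p)) with hc
  have hcfin : c ≠ ∞ := by
    refine ENNReal.mul_ne_top ENNReal.coe_ne_top (ENNReal.mul_ne_top ENNReal.ofNat_ne_top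
      (ENNReal.rpow_ne_top_of_nonneg (by have := hL.p_pos; positivity) (ENNReal.add_ne_top.2
        ⟨?_, ?_⟩)))
    · exact ENNReal.mul_ne_top (ENNReal.mul_ne_top ENNReal.ofNat_ne_top ENNReal.ofReal_ne_top)
        hL.memLp.eLpNorm_ne_top
    · exact ENNReal.mul_ne_top (ENNReal.mul_ne_top ENNReal.ofNat_ne_top ENNReal.ofReal_ne_top)
        hK.eLpNorm_ne_top
  -- Adding `1` ensures `1 ≤ A`, so that `log A` is nonnegative in the iteration.
  refine ⟨c.toReal + 1, D, by linarith [c.toReal_nonneg], hD, ?_⟩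
  rintro u ⟨G, hu, hsol⟩ γ a b hγ hra hab hbT
  have hγ0 : 0 < γ := by linarith
  have hk : 0 ≤ γ - 1 := by linarith
  have hq := hL.q_pos
  have hum := hu.hasWeakGradient.aestronglyMeasurable
  have haT : annulus N r (a : EReal) ⊆ annulus N r (T : EReal) :=
    annulus_subset_annulus (by exact_mod_cast (hab.le.trans hbT))
  set νa := (volume : Measure (EuclideanSpace ℝ (Fin N))).restrict (annulus N r (a : EReal))
    with hνa
  set νb := (volume : Measure (EuclideanSpace ℝ (Fin N))).restrict (annulus N r (b : EReal))
    with hνb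
  have hua : AEStronglyMeasurable u νa :=
    hum.mono_measure ((Measure.restrict_mono_set volume haT).trans hL.restrict_le)
  obtain ⟨η, hη, hη0, hη1, hηa, hηb, hηd⟩ := hcut a b (hL.r_pos.trans hra) hab
  have hba : 0 < b - a := sub_pos.2 hab
  have hΘ1 : 1 ≤ 1 + D / (b - a) := by
    have : 0 < D / (b - a) := by positivity
    linarith
  have hpow : ∀ t : ℝ, |t| * |t| ^ (γ - 1) = |t| ^ γ := fun t => by
    rw [mul_comm, ← Real.rpow_add_one' (abs_nonneg t) (by linarith), sub_add_cancel]
  have hpoweq : ∀ (e : ℝ) (ν : Measure (EuclideanSpace ℝ (Fin N))), 0 < e →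
      eLpNorm (fun x => u x * |u x| ^ (γ - 1)) (ENNReal.ofReal e) ν =
        eLpNorm u (ENNReal.ofReal (e * γ)) ν ^ γ := fun e ν he => by
    rw [ENNReal.ofReal_mul he.le, ← eLpNorm_norm_rpow _ hγ0]
    refine eLpNorm_congr_norm_ae (Eventually.of_forall fun x => ?_)
    rw [norm_mul, Real.norm_of_nonneg (Real.rpow_nonneg (abs_nonneg (u x)) _),
      Real.norm_of_nonneg (Real.rpow_nonneg (norm_nonneg (u x)) _), Real.norm_eq_abs, hpow]
  have hstep : ∀ n : ℕ, eLpNorm (fun x => u x * truncPow (γ - 1) n (u x)) (ENNReal.ofReal Q) νa ≤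
      ENNReal.ofReal γ * (c * (ENNReal.ofReal (1 + D / (b - a)) *
        eLpNorm u (ENNReal.ofReal (q * γ)) νb ^ γ)) := by
    intro n
    have hn : (0 : ℝ) ≤ n := n.cast_nonneg
    have h1 := hL.eLpNorm_mul_truncPowPrim_le hSq hSQ hKm hK hu hsol hk hn hbT hΘ1
      (hη.of_le (by simp)) hη0 hη1 hηb fun x => (hηd x).trans (by linarith)
    -- On `|x| < a` the cutoff equals `1`. Returning from the primitive to the product costs `k + 1
    -- = γ`, uniformly in the truncation level `n`.
    have h2 : eLpNorm (fun x => u x * truncPow (γ - 1) n (u x)) (ENNReal.ofReal Q) νa ≤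
        ENNReal.ofReal γ * eLpNorm (fun x => η x * truncPowPrim (γ - 1) n (u x))
          (ENNReal.ofReal Q) νa := by
      refine eLpNorm_le_mul_eLpNorm_of_ae_le_mul ?_ _
      filter_upwards [ae_restrict_mem (measurableSet_annulus _ _ _)] with x hx
      rw [hηa x (mem_annulus_coe.1 hx).2.le, one_mul, norm_mul,
        Real.norm_of_nonneg (truncPow_nonneg hn _)]
      simpa using abs_mul_truncPow_le hk hn (u x)
    refine h2.trans ?_
    gcongr
    have h3 : eLpNorm (fun x => η x * truncPowPrim (γ - 1) n (u x)) (ENNReal.ofReal Q)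
        (volume.restrict (annulus N r (T : EReal))) ≤ c * (ENNReal.ofReal (1 + D / (b - a)) *
          eLpNorm (fun x => u x * truncPow (γ - 1) n (u x)) (ENNReal.ofReal q) νb) :=
      h1.trans (le_of_eq (by rw [hc]; simp only [mul_assoc]; rfl))
    refine (eLpNorm_mono_measure _ (Measure.restrict_mono_set volume haT)).trans (h3.trans ?_)
    gcongr
    rw [← hpoweq q νb hq]
    refine eLpNorm_mono fun x => ?_
    rw [norm_mul, norm_mul, Real.norm_of_nonneg (truncPow_nonneg hn _),
      Real.norm_of_nonneg (Real.rpow_nonneg (abs_nonneg (u x)) _)]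
    gcongr
    exact truncPow_le_abs_rpow hk hn _
  -- At each point the truncation is inactive once `n ≥ |u x|`, so Fatou's lemma removes it.
  have hfat := Lp.eLpNorm_lim_le_liminf_eLpNorm (p := ENNReal.ofReal Q) (μ := νa)
    (f := fun (n : ℕ) x => u x * truncPow (γ - 1) n (u x))
    (fun n => hua.mul ((continuous_truncPow hk).comp_aestronglyMeasurable hua))
    (fun x => u x * |u x| ^ (γ - 1)) (Eventually.of_forall fun x => by
      refine tendsto_const_nhds.congr' ?_
      filter_upwards [eventually_ge_atTop ⌈|u x|⌉₊] with n hn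
      rw [truncPow, min_eq_left ((Nat.le_ceil _).trans (by exact_mod_cast hn))])
  have hlim : eLpNorm u (ENNReal.ofReal (Q * γ)) νa ^ γ ≤
      ENNReal.ofReal ((c.toReal + 1) * γ * (1 + D / (b - a))) *
        eLpNorm u (ENNReal.ofReal (q * γ)) νb ^ γ := by
    rw [← hpoweq Q νa hQ]
    refine hfat.trans ((liminf_le_liminf (Eventually.of_forall hstep)).trans ?_)
    rw [liminf_const, ENNReal.ofReal_mul (p := (c.toReal + 1) * γ) (by positivity),
      ENNReal.ofReal_mul (p := c.toReal + 1) (by positivity)]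
    have h3 : c ≤ ENNReal.ofReal (c.toReal + 1) := by
      rw [ENNReal.le_ofReal_iff_toReal_le hcfin (by positivity)]; linarith
    calc _ = c * ENNReal.ofReal γ * ENNReal.ofReal (1 + D / (b - a)) *
          eLpNorm u (ENNReal.ofReal (q * γ)) νb ^ γ := by ring
      _ ≤ _ := by gcongr
  have hroot := ENNReal.rpow_le_rpow hlim (by positivity : 0 ≤ 1 / γ)
  rwa [ENNReal.mul_rpow_of_nonneg _ _ (by positivity), ← ENNReal.rpow_mul, ← ENNReal.rpow_mul,
    mul_one_div_cancel hγ0.ne', ENNReal.rpow_one, ENNReal.rpow_one,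
    ENNReal.ofReal_rpow_of_nonneg (by positivity) (by positivity)] at hroot

/-- Moser's iteration: solutions are bounded near the inner boundary. -/
theorem exists_eLpNorm_top_le {ε : ℝ} (hε : 0 < ε)
    (hL : AdmissibleWeight N p q s r (r + 2 * ε) R L) {S S' : NNReal} {Q : ℝ}
    (hSq : SobolevBound N p r (r + 2 * ε) R L q S)
    (hSQ : SobolevBound N p r (r + 2 * ε) R L Q S') (hqQ : q < Q)
    (hKm : AEMeasurable K (volume.restrict (annulus N r R)))
    (hK : MemLp K (weightExp p q)
      (volume.restrict (annulus N r ((r + 2 * ε : ℝ) : EReal)))) (lam : ℝ) :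
    ∃ C : ℝ, 0 < C ∧ ∀ u, IsWeakSolution p (annulus N r R) L K lam u →
      eLpNorm u ∞ (volume.restrict (annulus N r ((r + ε : ℝ) : EReal))) ≤
        ENNReal.ofReal C * eLpNorm u (ENNReal.ofReal q)
          (volume.restrict (annulus N r ((r + 2 * ε : ℝ) : EReal))) := by
  have hq := hL.q_pos
  obtain ⟨A, D, hA, hD, hstep⟩ := hL.exists_moser_step hSq hSQ (hq.trans hqQ) hKm hK lam
  set χ := Q / q with hχ
  have hχ1 : 1 < χ := by rw [hχ, one_lt_div hq]; exact hqQ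
  have hχ0 : 0 < χ := by linarith
  have hDε : 0 < 2 * D / ε := by positivity
  -- Step `k` uses `γ = χ^k` and a gap of `ε 2^{-k} / 2` between radii. Its constant is at most `A
  -- χ^k (1 + 2D/ε) 2^k`, which is the first parameter times `(2χ)^k`.
  obtain ⟨C, hC, hiter⟩ := exists_bound_of_iteration (A := A * (1 + 2 * D / ε)) (B := 2 * χ)
    (χ := χ) (by nlinarith) (by linarith) hχ1
  refine ⟨C, hC, fun u hu => ?_⟩
  obtain ⟨G, hG, -⟩ := id hu
  have hum := hG.hasWeakGradient.aestronglyMeasurable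
  -- The radii decrease from `r + 2ε` towards `r + ε`, so every annulus contains the one where the
  -- sup norm is taken.
  set b : ℕ → ℝ := fun k => r + ε * (1 + (1 / 2) ^ k) with hb
  have hb0 : b 0 = r + 2 * ε := by simp [hb]; ring
  have hbT : ∀ k, b k ≤ r + 2 * ε := fun k => by
    have h1 : ((1 : ℝ) / 2) ^ k ≤ 1 := pow_le_one₀ (by norm_num) (by norm_num)
    simp only [hb]; nlinarith
  have hbl : ∀ k, r + ε ≤ b k := fun k => by
    have h1 : 0 ≤ ((1 : ℝ) / 2) ^ k := by positivity
    simp only [hb]; nlinarith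
  have hdiff : ∀ k, b k - b (k + 1) = ε * (1 / 2) ^ k / 2 := fun k => by
    simp only [hb, pow_succ]; ring
  have hbound := hiter (fun k => eLpNorm u (ENNReal.ofReal (q * χ ^ k))
    (volume.restrict (annulus N r (b k : EReal)))) (fun k => by
      have hpos : 0 < b k - b (k + 1) := by rw [hdiff]; positivity
      have h1 := hstep u hu (χ ^ k) (b (k + 1)) (b k) (one_le_pow₀ hχ1.le)
        (by linarith [hbl (k + 1)]) (by linarith) (hbT k)
      have h2 : Q * χ ^ k = q * χ ^ (k + 1) := by
        rw [pow_succ, hχ]; field_simp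
      rw [h2, hdiff] at h1
      refine h1.trans (mul_le_mul_left (ENNReal.ofReal_le_ofReal
        (Real.rpow_le_rpow (by positivity) ?_ (by positivity))) _)
      have h3 : D / (ε * (1 / 2) ^ k / 2) = 2 * D / ε * 2 ^ k := by
        rw [one_div, inv_pow]; field_simp
      have h4 : (1 : ℝ) ≤ 2 ^ k := one_le_pow₀ one_le_two
      rw [h3, mul_pow]
      have h5 : 1 + 2 * D / ε * 2 ^ k ≤ (1 + 2 * D / ε) * 2 ^ k := by nlinarith
      calc A * χ ^ k * (1 + 2 * D / ε * 2 ^ k) ≤ A * χ ^ k * ((1 + 2 * D / ε) * 2 ^ k) := by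
            gcongr
        _ = _ := by ring)
  refine eLpNorm_top_le_of_forall_eLpNorm_le (e := fun k => q * χ ^ k)
    (hum.mono_measure ((Measure.restrict_mono_set volume (annulus_subset_annulus
      (by exact_mod_cast (by linarith : r + ε ≤ r + 2 * ε)))).trans hL.restrict_le))
    (fun k => by positivity)
    ((tendsto_pow_atTop_atTop_of_one_lt hχ1).const_mul_atTop hq) fun k => ?_
  have h := hbound k
  simp only [hb0, pow_zero, mul_one] at h
  refine le_trans (eLpNorm_mono_measure _ (Measure.restrict_mono_set volume
    (annulus_subset_annulus (by exact_mod_cast hbl k)))) h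

end AdmissibleWeight

/-! ### Boundedness near the inner boundary -/

theorem theorem1p3 (N : ℕ) (hN : 1 ≤ N) (p : ℝ) (hp : 1 < p)
    (R₁ : ℝ) (hR₁ : 0 < R₁) (R₂ : EReal) (hR₂ : (R₁ : EReal) < R₂)
    (L K : EuclideanSpace ℝ (Fin N) → ℝ)
    (hLm : AEMeasurable L (volume.restrict (annulus N R₁ R₂)))
    (hLpos : ∀ᵐ x ∂(volume.restrict (annulus N R₁ R₂)), 0 < L x)
    (hLloc : LocallyIntegrableOn L (annulus N R₁ R₂))
    (hKm : AEMeasurable K (volume.restrict (annulus N R₁ R₂)))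
    (hKpos : 0 < volume {x ∈ annulus N R₁ R₂ | 0 < K x})
    (hA : ConditionA N p R₁ R₂ L K)
    (ε : ℝ) (hε : 0 < ε) (hεR₂ : ((R₁ + 2 * ε : ℝ) : EReal) < R₂)
    (s : ℝ) (hs : (N : ℝ) / p < s) (hs' : 1 / (p - 1) ≤ s)
    (q : ℝ) (hpq : p ≤ q) (hq : (q : EReal) < sobolevExp N (pSub p s))
    (hLs : IntegrableOn (fun x => L x ^ (-s)) (annulus N R₁ ((R₁ + 2 * ε : ℝ) : EReal)))
    (hLq : MemLp L (weightExp p q)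
      (volume.restrict (annulus N R₁ ((R₁ + 2 * ε : ℝ) : EReal))))
    (hKq : MemLp K (weightExp p q)
      (volume.restrict (annulus N R₁ ((R₁ + 2 * ε : ℝ) : EReal))))
    (lam : ℝ) :
    ∃ C μ : ℝ, 0 < C ∧ 0 < μ ∧
      ∀ u : EuclideanSpace ℝ (Fin N) → ℝ,
        IsWeakSolution p (annulus N R₁ R₂) L K lam u →
          MemLp u (ENNReal.ofReal q)
            (volume.restrict (annulus N R₁ ((R₁ + 2 * ε : ℝ) : EReal))) ∧
          MemLp u ∞ (volume.restrict (annulus N R₁ ((R₁ + ε : ℝ) : EReal))) ∧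
          eLpNorm u ∞ (volume.restrict (annulus N R₁ ((R₁ + ε : ℝ) : EReal))) ≤
            ENNReal.ofReal
              (C * (1 + (∫ x in annulus N R₁ ((R₁ + 2 * ε : ℝ) : EReal), |u x| ^ q) ^ μ)) := by
  have hL : AdmissibleWeight N p q s R₁ (R₁ + 2 * ε) R₂ L :=
    ⟨hp, hpq, hs', hR₁, by linarith, hεR₂, hLm, hLpos, hLloc, hLs, hLq⟩
  have hq0 := hL.q_pos
  obtain ⟨Q, hqQ, S', hSQ⟩ := exists_weighted_sobolev hN hp hR₁ hL.r_lt hεR₂.le hLm hLpos hs' hpq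
    hq hLs
  have hSQ' : SobolevBound N p R₁ (R₁ + 2 * ε) R₂ L Q S' := hSQ
  obtain ⟨S, hSq⟩ := hSQ'.exists_of_le hq0 hqQ.le
  obtain ⟨C, hC, hbound⟩ := hL.exists_eLpNorm_top_le hε hSq hSQ' hqQ hKm hKq lam
  -- The bound by `C` times the `L^q` norm is the integral to the power `1/q`; adding `1` only
  -- weakens it.
  refine ⟨C, 1 / q, hC, by positivity, fun u hu => ?_⟩
  have hb := hbound u hu
  obtain ⟨G, hG, -⟩ := hu
  have hw := hG.hasWeakGradient
  obtain ⟨φ, hφ⟩ := (hL.memD0_iff.1 hG).2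
  have huq : MemLp u (ENNReal.ofReal q)
      (volume.restrict (annulus N R₁ ((R₁ + 2 * ε : ℝ) : EReal))) :=
    ⟨hw.aestronglyMeasurable.mono_measure hL.restrict_le,
      (hL.eLpNorm_le_of_isApprox hSq hw.aestronglyMeasurable hw.aestronglyMeasurable_grad
        hφ).trans_lt (ENNReal.mul_lt_top ENNReal.coe_lt_top
          (hL.eLpNorm_grad_lt_top hw.aestronglyMeasurable_grad hφ))⟩
  refine ⟨huq, ⟨huq.1.mono_measure (Measure.restrict_mono_set volume (annulus_subset_annulus
      (by exact_mod_cast (by linarith : R₁ + ε ≤ R₁ + 2 * ε)))),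
      hb.trans_lt (ENNReal.mul_lt_top ENNReal.ofReal_lt_top huq.2)⟩, hb.trans ?_⟩
  rw [huq.eLpNorm_eq_integral_rpow_norm (by simpa using hq0) ENNReal.ofReal_ne_top,
    ← ENNReal.ofReal_mul hC.le, ENNReal.toReal_ofReal hq0.le]
  refine ENNReal.ofReal_le_ofReal ?_
  simp only [Real.norm_eq_abs, one_div]
  gcongr
  linarith
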